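/- For every $n\ge 3$ there is a function $\psi\in C^1(\mathbb R^n)$, homogeneous of degree $2$ (that is, $\psi(tx)=t^2\psi(x)$ for all $t\in\mathbb R$, $x\in\mathbb R^n$), such that the gradient map $f=\nabla\psi\colon\mathbb R^n\to\mathbb R^n$ has the following properties. 1. $f$ is nonconstant and quasiregular: it is continuous, belongs to $W^{1,n}_{\rm loc}(\mathbb R^n,\mathbb R^n)$, and there is $K\in[1,\infty)$ with $\|Df(x)\|^n\le K\det Df(x)$ for almost every $x$. 2. $f$ is a mapping of bounded length distortion (BLD): it is continuous, discrete, open and sense-preserving, and there is $L\ge 1$ such that $\ell(\alpha)/L\le \ell(f\circ\alpha)\le L\,\ell(\alpha)$ for every path $\alpha$ in $\mathbb R^n$, where $\ell$ denotes length. 3. $f$ is not a local homeomorphism; its branch set (the set of points at which $f$ is not a local homeomorphism) is exactly $\{x\in\mathbb R^n : x_1=x_2=0\}$. 4. At every point $x$ with $x_1=x_2=0$ the local topological index of $f$, that is, the Brouwer degree of $f$ at $f(x)$ on every sufficiently small ball centred at $x$, equals $3$. -/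

import Mathlib

open MeasureTheory Set
open scoped ContDiff NNReal ENNReal

/-- `G` is the weak (distributional) differential of `f` on `ℝⁿ`. -/
def HasWeakFDeriv {n : ℕ} (f : EuclideanSpace ℝ (Fin n) → EuclideanSpace ℝ (Fin n))
    (G : EuclideanSpace ℝ (Fin n) → EuclideanSpace ℝ (Fin n) →L[ℝ] EuclideanSpace ℝ (Fin n)) :
    Prop :=
  LocallyIntegrable f ∧ LocallyIntegrable G ∧
    ∀ φ : EuclideanSpace ℝ (Fin n) → ℝ, ContDiff ℝ ∞ φ → HasCompactSupport φ →
      ∀ v : EuclideanSpace ℝ (Fin n),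
        ∫ x, (fderiv ℝ φ x v) • f x = - ∫ x, φ x • G x v

/-- Quasiregular mappings `ℝⁿ → ℝⁿ`: continuous mappings of class `W^{1,n}_loc` satisfying the
distortion inequality `‖Df(x)‖ⁿ ≤ K J_f(x)` for almost every `x`, with some finite `K`. -/
def IsQuasiregularMap {n : ℕ} (f : EuclideanSpace ℝ (Fin n) → EuclideanSpace ℝ (Fin n)) : Prop :=
  Continuous f ∧
    ∃ G : EuclideanSpace ℝ (Fin n) → EuclideanSpace ℝ (Fin n) →L[ℝ] EuclideanSpace ℝ (Fin n),
      HasWeakFDeriv f G ∧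
      (∀ S : Set (EuclideanSpace ℝ (Fin n)), IsCompact S →
        MemLp f n (volume.restrict S) ∧ MemLp G n (volume.restrict S)) ∧
      ∃ K : ℝ, 1 ≤ K ∧ ∀ᵐ x, ‖G x‖ ^ n ≤ K * (G x).det

/-- `d` is the (Brouwer) degree at `y` of the locally Lipschitz map `f` on the bounded open set `U`,
where `y ∉ f(∂U)`. This is the analytic definition of the degree:
`∫_U φ(f(x)) J_f(x) dx = d ∫ φ` for all continuous `φ` supported near `y`.
By Rademacher's theorem `J_f` exists almost everywhere and is bounded on `U`, so that the integrands
are integrable; the equation determines `d`. -/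
def HasDegree {n : ℕ} (f : EuclideanSpace ℝ (Fin n) → EuclideanSpace ℝ (Fin n))
    (U : Set (EuclideanSpace ℝ (Fin n))) (y : EuclideanSpace ℝ (Fin n)) (d : ℤ) : Prop :=
  LocallyLipschitz f ∧ IsOpen U ∧ Bornology.IsBounded U ∧ y ∉ f '' frontier U ∧
    ∃ ε : ℝ, 0 < ε ∧ ∀ φ : EuclideanSpace ℝ (Fin n) → ℝ, Continuous φ →
      tsupport φ ⊆ Metric.ball y ε →
        ∫ x in U, φ (f x) * (fderiv ℝ f x).det = (d : ℝ) * ∫ z, φ z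

/-- `d` is the local (topological) index of the locally Lipschitz map `f` at `x`: the point `x` is
isolated in its fibre, and the degree of `f` at `f x` on every sufficiently small ball about `x`
is `d`. -/
def HasLocalIndex {n : ℕ} (f : EuclideanSpace ℝ (Fin n) → EuclideanSpace ℝ (Fin n))
    (x : EuclideanSpace ℝ (Fin n)) (d : ℤ) : Prop :=
  ∃ r : ℝ, 0 < r ∧ (∀ z ∈ Metric.closedBall x r, f z = f x → z = x) ∧
    ∀ ρ : ℝ, 0 < ρ → ρ ≤ r → HasDegree f (Metric.ball x ρ) (f x) d

/-- A locally Lipschitz map is sense-preserving if its degree on every bounded domain `D` is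
positive at every point of `f(D) \ f(∂D)`. -/
def IsSensePreserving {n : ℕ} (f : EuclideanSpace ℝ (Fin n) → EuclideanSpace ℝ (Fin n)) : Prop :=
  ∀ D : Set (EuclideanSpace ℝ (Fin n)), IsOpen D → IsConnected D → Bornology.IsBounded D →
    ∀ y ∈ f '' D \ f '' frontier D, ∃ d : ℤ, 0 < d ∧ HasDegree f D y d

/-- Mappings `ℝⁿ → ℝⁿ` of bounded length distortion: continuous, discrete, open and
sense-preserving mappings that distort the length of every path by at most a fixed factor `L`
(in both directions; lengths may be infinite). Such mappings are `L`-Lipschitz, so that the degree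
of locally Lipschitz maps suffices for the definition. -/
def IsBLD {n : ℕ} (f : EuclideanSpace ℝ (Fin n) → EuclideanSpace ℝ (Fin n)) : Prop :=
  Continuous f ∧ (∀ y, DiscreteTopology (f ⁻¹' {y})) ∧ IsOpenMap f ∧ IsSensePreserving f ∧
    ∃ L : ℝ≥0, 1 ≤ L ∧ ∀ (a b : ℝ) (α : ℝ → EuclideanSpace ℝ (Fin n)),
      a ≤ b → ContinuousOn α (Icc a b) →
        eVariationOn α (Icc a b) ≤ L * eVariationOn (f ∘ α) (Icc a b) ∧
        eVariationOn (f ∘ α) (Icc a b) ≤ L * eVariationOn α (Icc a b)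

/-- The branch set: the points at which `f` fails to be a local homeomorphism. -/
def branchSet {n : ℕ} (f : EuclideanSpace ℝ (Fin n) → EuclideanSpace ℝ (Fin n)) :
    Set (EuclideanSpace ℝ (Fin n)) :=
  {x | ¬ IsLocalHomeomorphOn f {x}}

open Filter Topology

/-! ### Comparison of lengths from a pointwise comparison of distances -/

/-! In polar coordinates of the `(x_i, x_j)`-plane the potential is `½ ρ² cos 4θ` plus `½` the sum
of the squares of the other coordinates, except that `x_k²` enters with coefficient `-½`. Its
gradient is thus a planar map, times the reflection `x_k ↦ -x_k`, times the identity. The planar map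
is `ρ e^{iθ} (cos 4θ - 2i sin 4θ)`. It winds `1 - 4 = -3` times around the origin, and its Jacobian
is `-4 - 3 cos² 4θ`. The reflection, for which a third coordinate is needed, turns degree `-3` into
`3` and makes the Jacobian at least `4`.

The gradient is homogeneous of degree 1 and commutes with translations along the axis `x_i = x_j =
0` up to an additive constant. The planar map does not decrease the norm
(`sq_add_sq_le_of_quinticQuotient`), so distances to points of the axis are not decreased. Off the
axis the differential is bounded and has bounded inverse. These facts are collected in
`IsDiffeoOff`.

Everything topological follows from `IsDiffeoOff`. Expansion towards the axis `B` makes the map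
proper. Since `Bᶜ` is connected, the map is onto, and the number `N` of preimages is the same for
all points of `Bᶜ`. The measure with density the Jacobian is pushed forward to `N` times Lebesgue
measure (`map_jacobianMeasure`), which gives the local index `N` on `B`; off `B` it is 1. Degrees
are sums of local indices, hence positive. Length distortion follows from local distance
comparisons. Finally `N = 3`, by solving for the fibre of one point
(`exists_quinticQuotient_fiber`). -/

theorem edist_le_mul_eVariationOn {X Y : Type*} [PseudoEMetricSpace X] [PseudoEMetricSpace Y]
    {α : ℝ → X} {β : ℝ → Y} {L : ℝ≥0∞} {a b : ℝ} (hab : a ≤ b)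
    (h : ∀ t ∈ Icc a b, ∀ᶠ s in 𝓝[Icc a b] t, edist (α s) (α t) ≤ L * edist (β s) (β t)) :
    edist (α a) (α b) ≤ L * eVariationOn β (Icc a b) := by
  have trans : ∀ {s t : ℝ}, a ≤ s → s ≤ t →
      edist (α a) (α s) ≤ L * eVariationOn β (Icc a s) →
      edist (α s) (α t) ≤ L * edist (β s) (β t) →
      edist (α a) (α t) ≤ L * eVariationOn β (Icc a t) := by
    intro s t has hst h₁ h₂
    have key := eVariationOn.Icc_add_Icc β (s := univ) has hst (mem_univ _)
    simp only [univ_inter] at key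
    calc edist (α a) (α t) ≤ edist (α a) (α s) + edist (α s) (α t) := edist_triangle _ _ _
      _ ≤ L * eVariationOn β (Icc a s) + L * eVariationOn β (Icc s t) := by
          refine add_le_add h₁ (h₂.trans ?_)
          gcongr
          exact eVariationOn.edist_le β (left_mem_Icc.2 hst) (right_mem_Icc.2 hst)
      _ = _ := by rw [← mul_add, key]
  -- Continuous induction: the hypothesis at the supremum `c` of `S` compares `c` with points on
  -- both sides. This puts `c` in `S`, and then a point beyond `c` if `c < b`. Neither curve need be
  -- continuous.
  set S : Set ℝ := {t | t ∈ Icc a b ∧ edist (α a) (α t) ≤ L * eVariationOn β (Icc a t)} with hS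
  have haS : a ∈ S := ⟨left_mem_Icc.2 hab, by simp⟩
  have hbdd : BddAbove S := ⟨b, fun t ht => ht.1.2⟩
  set c := sSup S with hc
  have hac : a ≤ c := le_csSup hbdd haS
  have hcb : c ≤ b := csSup_le ⟨a, haS⟩ fun t ht => ht.1.2
  obtain ⟨δ, hδ, hball⟩ := Metric.mem_nhdsWithin_iff.1 (h c ⟨hac, hcb⟩)
  have hcS : c ∈ S := by
    obtain ⟨t, htS, ht⟩ := exists_lt_of_lt_csSup ⟨a, haS⟩ (sub_lt_self c hδ)
    have htc : t ≤ c := le_csSup hbdd htS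
    refine ⟨⟨hac, hcb⟩, trans htS.1.1 htc htS.2 (hball ⟨?_, htS.1⟩)⟩
    rw [Metric.mem_ball, Real.dist_eq, abs_lt]
    constructor <;> linarith
  rcases hcb.eq_or_lt with hcb' | hcb'
  · rw [← hcb']
    exact hcS.2
  · exfalso
    set t := min b (c + δ / 2) with ht
    have hct : c < t := lt_min hcb' (by linarith)
    have htb : t ≤ b := min_le_left _ _
    have htd : t ≤ c + δ / 2 := min_le_right _ _
    have : t ∈ S := by
      have htI : t ∈ Icc a b := ⟨hac.trans hct.le, htb⟩
      refine ⟨htI, trans hac hct.le hcS.2 ?_⟩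
      rw [edist_comm (α c), edist_comm (β c)]
      refine hball ⟨?_, htI⟩
      rw [Metric.mem_ball, Real.dist_eq, abs_lt]
      constructor <;> linarith
    exact absurd (le_csSup hbdd this) (not_le.2 hct)

theorem eVariationOn_le_mul_eVariationOn {X Y : Type*} [PseudoEMetricSpace X]
    [PseudoEMetricSpace Y] {α : ℝ → X} {β : ℝ → Y} {L : ℝ≥0∞} {a b : ℝ}
    (h : ∀ t ∈ Icc a b, ∀ᶠ s in 𝓝[Icc a b] t, edist (α s) (α t) ≤ L * edist (β s) (β t)) :
    eVariationOn α (Icc a b) ≤ L * eVariationOn β (Icc a b) := by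
  refine iSup_le ?_
  rintro ⟨N, u, hu, hus⟩
  calc ∑ i ∈ Finset.range N, edist (α (u (i + 1))) (α (u i))
      ≤ ∑ i ∈ Finset.range N, L * eVariationOn β (Icc (u i) (u (i + 1))) := by
        refine Finset.sum_le_sum fun i _ => ?_
        rw [edist_comm]
        refine edist_le_mul_eVariationOn (hu i.le_succ) fun t ht => ?_
        have hsub : Icc (u i) (u (i + 1)) ⊆ Icc a b := Icc_subset_Icc (hus i).1 (hus (i + 1)).2
        exact nhdsWithin_mono _ hsub (h t (hsub ht))
    _ = L * eVariationOn β (Icc (u 0) (u N)) := by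
        rw [← Finset.mul_sum, eVariationOn.sum' β hu]
    _ ≤ _ := by
        gcongr
        exact eVariationOn.mono _ (Icc_subset_Icc (hus 0).1 (hus N).2)

/-- The local bounds add up along the segment from `x` to `y`, whose variation is at most `edist x
y`. No uniformity in the size of the neighbourhoods is needed. -/
theorem LipschitzWith.of_eventually_edist_le {E Y : Type*} [NormedAddCommGroup E]
    [NormedSpace ℝ E] [PseudoEMetricSpace Y] {f : E → Y} {C : ℝ≥0}
    (h : ∀ x, ∀ᶠ y in 𝓝 x, edist (f y) (f x) ≤ C * edist y x) : LipschitzWith C f := by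
  intro x y
  set γ : ℝ → E := fun t => AffineMap.lineMap x y t with hγ
  have hγc : Continuous γ := AffineMap.lineMap_continuous
  have key := edist_le_mul_eVariationOn (α := f ∘ γ) (β := γ) (L := C) zero_le_one
    fun t _ => (hγc.tendsto t).mono_left nhdsWithin_le_nhds |>.eventually (h (γ t))
  have hlip : LipschitzWith (nndist x y) γ := lipschitzWith_lineMap x y
  have hvar : eVariationOn γ (Icc 0 1) ≤ edist x y := by
    have h₁ := (hlip.lipschitzOnWith (s := univ)).comp_eVariationOn_le
      (g := (id : ℝ → ℝ)) (s := Icc 0 1) (mapsTo_univ _ _)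
    have h₂ := (monotone_id.monotoneOn (Icc (0 : ℝ) 1)).eVariationOn_eq
      (left_mem_Icc.2 zero_le_one) (right_mem_Icc.2 zero_le_one)
    simp only [inter_self, id, sub_zero, ENNReal.ofReal_one] at h₂
    calc eVariationOn γ (Icc 0 1) ≤ nndist x y * eVariationOn id (Icc (0 : ℝ) 1) := h₁
      _ ≤ nndist x y * 1 := by rw [h₂]
      _ = edist x y := by rw [mul_one, edist_nndist]
  calc edist (f x) (f y) = edist ((f ∘ γ) 0) ((f ∘ γ) 1) := by simp [hγ]
    _ ≤ C * eVariationOn γ (Icc 0 1) := key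
    _ ≤ _ := by gcongr

/-- Near `x` the remainder is at most `‖y - x‖ / (2c)`, half of the lower bound for the linear part;
this costs the factor 2. -/
theorem eventually_edist_le_of_hasFDerivAt {E F : Type*} [NormedAddCommGroup E]
    [NormedSpace ℝ E] [NormedAddCommGroup F] [NormedSpace ℝ F] {f : E → F} {A : E →L[ℝ] F} {x : E}
    {c : ℝ≥0} (hc : 0 < c) (hf : HasFDerivAt f A x) (hA : ∀ v, ‖v‖ ≤ c * ‖A v‖) :
    ∀ᶠ y in 𝓝 x, edist y x ≤ (2 * c : ℝ≥0) * edist (f y) (f x) := by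
  have hc' : (0 : ℝ) < c := hc
  filter_upwards [hf.isLittleO.def (c := (2 * c : ℝ)⁻¹) (by positivity)] with y hy
  have h₁ := hA (y - x)
  have h₂ : ‖A (y - x)‖ ≤ ‖f y - f x‖ + ‖f y - f x - A (y - x)‖ := by
    have := norm_sub_le (f y - f x) (f y - f x - A (y - x))
    rwa [sub_sub_cancel] at this
  have h₃ : (c : ℝ) * ((2 * c : ℝ)⁻¹ * ‖y - x‖) = ‖y - x‖ / 2 := by field_simp
  have h₄ : ‖y - x‖ ≤ 2 * c * ‖f y - f x‖ := by
    have := mul_le_mul_of_nonneg_left (h₂.trans (add_le_add_right hy _)) hc'.le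
    rw [mul_add, h₃] at this
    linarith
  rw [edist_dist, edist_dist, dist_eq_norm, dist_eq_norm, ← ENNReal.ofReal_coe_nnreal,
    ← ENNReal.ofReal_mul (by positivity)]
  exact ENNReal.ofReal_le_ofReal (by push_cast; exact h₄)

/-! ### Weak differentiability of Lipschitz maps -/

section WeakDeriv

variable {n : ℕ} {f : EuclideanSpace ℝ (Fin n) → EuclideanSpace ℝ (Fin n)} {L : ℝ≥0}

theorem LipschitzWith.memLp_fderiv_restrict (hf : LipschitzWith L f) (p : ℝ≥0∞)
    {S : Set (EuclideanSpace ℝ (Fin n))} (hS : IsCompact S) :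
    MemLp (fderiv ℝ f) p (volume.restrict S) := by
  have : IsFiniteMeasure (volume.restrict S) := ⟨by simpa using hS.measure_lt_top⟩
  exact MemLp.of_bound (measurable_fderiv ℝ f).aestronglyMeasurable L
    (Eventually.of_forall fun x => norm_fderiv_le_of_lipschitz ℝ hf)

/-- Coordinate by coordinate, this is integration by parts for line derivatives of Lipschitz
functions. Rademacher's theorem identifies the line derivative with the differential almost
everywhere. -/
theorem LipschitzWith.hasWeakFDeriv (hf : LipschitzWith L f) :
    HasWeakFDeriv f (fderiv ℝ f) := by
  have hG : LocallyIntegrable (fderiv ℝ f) := by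
    refine locallyIntegrable_iff.2 fun S hS => ?_
    have : IsFiniteMeasure (volume.restrict S) := ⟨by simpa using hS.measure_lt_top⟩
    exact (hf.memLp_fderiv_restrict 1 hS).integrable le_rfl
  refine ⟨hf.continuous.locallyIntegrable, hG, fun φ hφ hφc v => ?_⟩
  obtain ⟨D, hD⟩ := hφ.lipschitzWith_of_hasCompactSupport hφc (by simp)
  have hφ' : Continuous fun x => fderiv ℝ φ x v :=
    (hφ.continuous_fderiv (by simp)).clm_apply continuous_const
  have hi₁ : Integrable fun x => (fderiv ℝ φ x v) • f x :=
    (hφ'.smul hf.continuous).integrable_of_hasCompactSupport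
      (HasCompactSupport.smul_right (hφc.fderiv_apply ℝ v))
  have hi₂ : Integrable fun x => φ x • fderiv ℝ f x v := by
    have h₁ : Integrable fun x => φ x • fderiv ℝ f x :=
      hG.integrable_smul_left_of_hasCompactSupport hφ.continuous hφc
    exact (ContinuousLinearMap.apply ℝ (EuclideanSpace ℝ (Fin n)) v).integrable_comp h₁
  ext i
  have e₁ := (EuclideanSpace.proj (𝕜 := ℝ) i).integral_comp_comm hi₁
  have e₂ := (EuclideanSpace.proj (𝕜 := ℝ) i).integral_comp_comm hi₂
  simp only [PiLp.proj_apply, PiLp.smul_apply, smul_eq_mul] at e₁ e₂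
  rw [PiLp.neg_apply, ← e₁, ← e₂]
  have hfi : LipschitzWith L fun x => f x i := by
    refine LipschitzWith.of_dist_le_mul fun x y => (le_trans ?_ (hf.dist_le_mul x y))
    rw [dist_eq_norm, dist_eq_norm]
    exact PiLp.norm_apply_le (f x - f y) i
  have key := hfi.integral_lineDeriv_mul_eq (μ := volume) hD hφc v
  have h₁ : ∀ᵐ x, lineDeriv ℝ (fun x => f x i) x v * φ x = φ x * (fderiv ℝ f x v) i := by
    filter_upwards [hf.ae_differentiableAt (μ := volume)] with x hx
    have : HasFDerivAt (fun x => f x i)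
        ((EuclideanSpace.proj (𝕜 := ℝ) i).comp (fderiv ℝ f x)) x :=
      (EuclideanSpace.proj (𝕜 := ℝ) i).hasFDerivAt.comp x hx.hasFDerivAt
    rw [(this.hasLineDerivAt v).lineDeriv, mul_comm]
    simp
  have h₂ : ∀ x, lineDeriv ℝ φ x (-v) * f x i = - (fderiv ℝ φ x v * f x i) := by
    intro x
    rw [(hφ.differentiable (by simp) x).lineDeriv_eq_fderiv, map_neg, neg_mul]
  rw [integral_congr_ae h₁, integral_congr_ae (Eventually.of_forall h₂), integral_neg] at key
  linarith

theorem LipschitzWith.isQuasiregularMap (hf : LipschitzWith L f) {c : ℝ} (hc : 0 < c)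
    (hdet : ∀ᵐ x, c ≤ (fderiv ℝ f x).det) : IsQuasiregularMap f := by
  refine ⟨hf.continuous, fderiv ℝ f, hf.hasWeakFDeriv, fun S hS =>
    ⟨?_, hf.memLp_fderiv_restrict n hS⟩, max 1 ((L : ℝ) ^ n / c), le_max_left _ _, ?_⟩
  · have : IsFiniteMeasure (volume.restrict S) := ⟨by simpa using hS.measure_lt_top⟩
    obtain ⟨C, hC⟩ := hS.exists_bound_of_continuousOn hf.continuous.continuousOn
    exact MemLp.of_bound hf.continuous.aestronglyMeasurable C
      (ae_restrict_of_forall_mem hS.measurableSet hC)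
  · filter_upwards [hdet] with x hx
    calc ‖fderiv ℝ f x‖ ^ n ≤ (L : ℝ) ^ n := by
          gcongr
          exact norm_fderiv_le_of_lipschitz ℝ hf
      _ = (L : ℝ) ^ n / c * c := by field_simp
      _ ≤ max 1 ((L : ℝ) ^ n / c) * (fderiv ℝ f x).det := by
          gcongr
          exact le_max_right _ _

end WeakDeriv

/-! ### Degrees and local indices -/

section Degree

variable {n : ℕ} {f : EuclideanSpace ℝ (Fin n) → EuclideanSpace ℝ (Fin n)} {L : ℝ≥0}

theorem LipschitzWith.integrableOn_comp_mul_det_fderiv (hf : LipschitzWith L f)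
    {U : Set (EuclideanSpace ℝ (Fin n))} (hU : Bornology.IsBounded U)
    {φ : EuclideanSpace ℝ (Fin n) → ℝ} (hφ : Continuous φ) :
    IntegrableOn (fun x => φ (f x) * (fderiv ℝ f x).det) U := by
  have hK : IsCompact (closure U) := hU.isCompact_closure
  obtain ⟨C, hC⟩ := (isCompact_closedBall
    (0 : EuclideanSpace ℝ (Fin n) →L[ℝ] EuclideanSpace ℝ (Fin n)) L).exists_bound_of_continuousOn
    ContinuousLinearMap.continuous_det.continuousOn
  have hdet : Measurable fun x => (fderiv ℝ f x).det :=
    ContinuousLinearMap.continuous_det.measurable.comp (measurable_fderiv ℝ f)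
  have hφf : IntegrableOn (fun x => φ (f x)) (closure U) :=
    (hφ.comp hf.continuous).continuousOn.integrableOn_compact hK
  refine (hφf.mono_set subset_closure).mul_bdd (c := C) hdet.aestronglyMeasurable ?_
  refine Eventually.of_forall fun x => hC _ ?_
  rw [mem_closedBall_zero_iff]
  exact norm_fderiv_le_of_lipschitz ℝ hf

/-- The degree on a bounded open set is the sum of the local indices over the fibre. -/
theorem LipschitzWith.hasDegree_sum_of_hasLocalIndex (hf : LipschitzWith L f)
    {D : Set (EuclideanSpace ℝ (Fin n))} (hDo : IsOpen D) (hDb : Bornology.IsBounded D)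
    {y : EuclideanSpace ℝ (Fin n)} (hy : y ∉ f '' frontier D)
    {F : Finset (EuclideanSpace ℝ (Fin n))} (hF : ∀ x, x ∈ F ↔ x ∈ D ∧ f x = y)
    {i : EuclideanSpace ℝ (Fin n) → ℤ} (hi : ∀ x ∈ F, HasLocalIndex f x (i x)) :
    HasDegree f D y (∑ x ∈ F, i x) := by
  refine ⟨hf.locallyLipschitz, hDo, hDb, hy, ?_⟩
  obtain ⟨U, hU, hUd⟩ := F.finite_toSet.t2_separation
  have hloc : ∀ x ∈ F, ∃ ρ ε : ℝ, 0 < ρ ∧ 0 < ε ∧ Metric.ball x ρ ⊆ U x ∩ D ∧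
      ∀ φ : EuclideanSpace ℝ (Fin n) → ℝ, Continuous φ → tsupport φ ⊆ Metric.ball y ε →
        ∫ x in Metric.ball x ρ, φ (f x) * (fderiv ℝ f x).det = (i x : ℝ) * ∫ z, φ z := by
    intro x hx
    obtain ⟨hxD, rfl⟩ := (hF x).1 hx
    obtain ⟨r, hr, -, hdeg⟩ := hi x hx
    obtain ⟨ρ, hρ, hsub⟩ := Metric.isOpen_iff.1 ((hU x).2.inter hDo) x ⟨(hU x).1, hxD⟩
    obtain ⟨-, -, -, -, ε, hε, h⟩ := hdeg (min ρ r) (lt_min hρ hr) (min_le_right _ _)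
    exact ⟨min ρ r, ε, lt_min hρ hr, hε,
      (Metric.ball_subset_ball (min_le_left _ _)).trans hsub, h⟩
  choose! ρ ε hρ hε hsub hint using hloc
  set V : Set (EuclideanSpace ℝ (Fin n)) := ⋃ x ∈ F, Metric.ball x (ρ x) with hV
  have hVo : IsOpen V := isOpen_biUnion fun x _ => Metric.isOpen_ball
  have hVD : V ⊆ D := iUnion₂_subset fun x hx => (hsub x hx).trans inter_subset_right
  -- Excision: the compact set `closure D \ V` misses the fibre, so its image stays away from `y`. A
  -- function supported close enough to `y` therefore sees only the balls around the fibre points.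
  have hK : IsCompact (closure D \ V) := hDb.isCompact_closure.diff hVo
  have hyK : y ∉ f '' (closure D \ V) := by
    rintro ⟨x, ⟨hxD, hxV⟩, hxy⟩
    by_cases hx : x ∈ D
    · have hxF := (hF x).2 ⟨hx, hxy⟩
      exact hxV (mem_biUnion hxF (Metric.mem_ball_self (hρ x hxF)))
    · exact hy ⟨x, ⟨hxD, by rwa [hDo.interior_eq]⟩, hxy⟩
  obtain ⟨ε₀, hε₀, hball⟩ :=
    Metric.isOpen_iff.1 (hK.image hf.continuous).isClosed.isOpen_compl y hyK
  obtain ⟨δ, ⟨hδ₀, hδF⟩, hδ⟩ : ∃ δ, (δ < ε₀ ∧ ∀ x ∈ F, δ < ε x) ∧ 0 < δ := by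
    have h₁ : ∀ᶠ δ in 𝓝[>] (0 : ℝ), δ < ε₀ ∧ ∀ x ∈ F, δ < ε x :=
      ((eventually_lt_nhds hε₀).and ((Finset.eventually_all F).2 fun x hx =>
        eventually_lt_nhds (hε x hx))).filter_mono nhdsWithin_le_nhds
    exact (h₁.and self_mem_nhdsWithin).exists
  refine ⟨δ, hδ, fun φ hφ hsupp => ?_⟩
  have hzero : ∀ x ∈ D \ V, φ (f x) * (fderiv ℝ f x).det = 0 := by
    intro x hx
    have : φ (f x) = 0 := by
      by_contra hne
      exact hball (Metric.ball_subset_ball hδ₀.le (hsupp (subset_tsupport _ hne)))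
        ⟨x, ⟨subset_closure hx.1, hx.2⟩, rfl⟩
    rw [this, zero_mul]
  rw [setIntegral_eq_of_subset_of_forall_sdiff_eq_zero hDo.measurableSet hVD hzero, hV,
    integral_biUnion_finset F (fun x _ => measurableSet_ball)
      (fun x hx z hz hxz => (hUd hx hz hxz).mono ((hsub x hx).trans inter_subset_left)
        ((hsub z hz).trans inter_subset_left))
      (fun x _ => hf.integrableOn_comp_mul_det_fderiv Metric.isBounded_ball hφ)]
  push_cast
  rw [Finset.sum_mul]
  exact Finset.sum_congr rfl fun x hx =>
    hint x hx φ hφ (hsupp.trans (Metric.ball_subset_ball (hδF x hx).le))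

end Degree

/-! ### Lipschitz maps that are local diffeomorphisms off a small closed set -/

/-- A Lipschitz map that is a sense-preserving local diffeomorphism, with locally uniformly
Lipschitz inverse branches, off a closed null set `B` which does not disconnect the space, and
that expands distances to the points of `B`. -/
structure IsDiffeoOff {n : ℕ} (f : EuclideanSpace ℝ (Fin n) → EuclideanSpace ℝ (Fin n))
    (B : Set (EuclideanSpace ℝ (Fin n))) : Prop where
  isClosed : IsClosed B
  nonempty : B.Nonempty
  null : volume B = 0
  preconnected : IsPreconnected Bᶜ
  mem_iff : ∀ x, f x ∈ B ↔ x ∈ B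
  lipschitz : ∃ L : ℝ≥0, LipschitzWith L f
  hasStrictFDerivAt : ∀ x ∉ B, HasStrictFDerivAt f (fderiv ℝ f x) x
  det_pos : ∀ x ∉ B, 0 < (fderiv ℝ f x).det
  norm_le : ∃ c : ℝ≥0, 0 < c ∧ ∀ x ∉ B, ∀ v, ‖v‖ ≤ c * ‖fderiv ℝ f x v‖
  dist_le : ∀ b ∈ B, ∀ x, dist x b ≤ dist (f x) (f b)

namespace IsDiffeoOff

variable {n : ℕ} {f : EuclideanSpace ℝ (Fin n) → EuclideanSpace ℝ (Fin n)}
  {B : Set (EuclideanSpace ℝ (Fin n))}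

theorem continuous (h : IsDiffeoOff f B) : Continuous f :=
  let ⟨_, hL⟩ := h.lipschitz
  hL.continuous

theorem exists_eventually_edist_le (h : IsDiffeoOff f B) :
    ∃ C : ℝ≥0, ∀ x, ∀ᶠ y in 𝓝 x, edist y x ≤ C * edist (f y) (f x) := by
  obtain ⟨c, hc, hcB⟩ := h.norm_le
  refine ⟨max 1 (2 * c), fun x => ?_⟩
  by_cases hx : x ∈ B
  · refine Eventually.of_forall fun y => ?_
    calc edist y x ≤ 1 * edist (f y) (f x) := by
          rw [one_mul, edist_dist, edist_dist]
          exact ENNReal.ofReal_le_ofReal (h.dist_le x hx y)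
      _ ≤ _ := by
          gcongr
          exact_mod_cast le_max_left _ _
  · filter_upwards [eventually_edist_le_of_hasFDerivAt hc (h.hasStrictFDerivAt x hx).hasFDerivAt
      (hcB x hx)] with y hy
    refine hy.trans ?_
    gcongr
    exact le_max_right _ _

theorem discreteTopology_fiber (h : IsDiffeoOff f B) (y : EuclideanSpace ℝ (Fin n)) :
    DiscreteTopology (f ⁻¹' {y}) := by
  obtain ⟨C, hC⟩ := h.exists_eventually_edist_le
  rw [discreteTopology_subtype_iff]
  intro x hx
  rw [← disjoint_iff, disjoint_principal_right, mem_nhdsWithin_iff_eventually]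
  filter_upwards [hC x] with z hz hzx hzy
  refine hzx ?_
  have hx' : f x = y := hx
  have hz' : f z = y := hzy
  rwa [hz', hx', edist_self, mul_zero, nonpos_iff_eq_zero, edist_eq_zero] at hz

/-- Expansion towards a single point of `B` already keeps preimages of bounded sets bounded. -/
theorem isCompact_preimage (h : IsDiffeoOff f B) {K : Set (EuclideanSpace ℝ (Fin n))}
    (hK : IsCompact K) : IsCompact (f ⁻¹' K) := by
  obtain ⟨b, hb⟩ := h.nonempty
  refine Metric.isCompact_of_isClosed_isBounded (hK.isClosed.preimage h.continuous) ?_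
  obtain ⟨r, hr⟩ := hK.isBounded.subset_closedBall (f b)
  exact Metric.isBounded_closedBall.subset fun x hx =>
    show x ∈ Metric.closedBall b r from (h.dist_le b hb x).trans (hr hx)

theorem isClosedMap (h : IsDiffeoOff f B) : IsClosedMap f :=
  (isProperMap_iff_isCompact_preimage.2
    ⟨h.continuous, fun _ hK => h.isCompact_preimage hK⟩).isClosedMap

theorem finite_fiber (h : IsDiffeoOff f B) (y : EuclideanSpace ℝ (Fin n)) :
    (f ⁻¹' {y}).Finite :=
  have := h.discreteTopology_fiber y
  (h.isCompact_preimage isCompact_singleton).finite ⟨this⟩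

theorem exists_openPartialHomeomorph (h : IsDiffeoOff f B) {x : EuclideanSpace ℝ (Fin n)}
    (hx : x ∉ B) :
    ∃ e : OpenPartialHomeomorph (EuclideanSpace ℝ (Fin n)) (EuclideanSpace ℝ (Fin n)),
      x ∈ e.source ∧ f = e := by
  have hs := h.hasStrictFDerivAt x hx
  rw [← ContinuousLinearMap.coe_toContinuousLinearEquivOfDetNeZero _ (h.det_pos x hx).ne'] at hs
  exact ⟨hs.toOpenPartialHomeomorph f, hs.mem_toOpenPartialHomeomorph_source, rfl⟩

theorem isOpen_image (h : IsDiffeoOff f B) {U : Set (EuclideanSpace ℝ (Fin n))} (hU : IsOpen U)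
    (hUB : U ⊆ Bᶜ) : IsOpen (f '' U) := by
  rw [isOpen_iff_mem_nhds]
  rintro _ ⟨x, hx, rfl⟩
  obtain ⟨e, hxe, rfl⟩ := h.exists_openPartialHomeomorph (hUB hx)
  rw [← e.map_nhds_eq hxe]
  exact image_mem_map (hU.mem_nhds hx)

theorem dense_compl (h : IsDiffeoOff f B) : Dense Bᶜ := by
  rw [← interior_eq_empty_iff_dense_compl]
  by_contra hne
  exact (isOpen_interior.measure_pos volume (nonempty_iff_ne_empty.2 hne)).ne'
    (measure_mono_null interior_subset h.null)

/-- The image of `Bᶜ` is open, and it is relatively closed in `Bᶜ` because `f` is closed and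
preserves both `B` and its complement. Connectedness gives all of `Bᶜ`, which is dense, and the
range is closed. -/
theorem surjective (h : IsDiffeoOff f B) : Function.Surjective f := by
  have hcl : IsClosed (range f) := h.isClosedMap.isClosed_range
  have hsub : Bᶜ ⊆ f '' Bᶜ := by
    obtain ⟨x, hx⟩ := h.dense_compl.nonempty
    refine h.preconnected.subset_of_closure_inter_subset
      (h.isOpen_image h.isClosed.isOpen_compl Subset.rfl)
      ⟨f x, fun hfx => hx ((h.mem_iff x).1 hfx), mem_image_of_mem f hx⟩ ?_
    rintro z ⟨hz, hzB⟩
    obtain ⟨w, rfl⟩ := closure_minimal (image_subset_range f _) hcl hz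
    exact mem_image_of_mem f fun hw => hzB ((h.mem_iff w).2 hw)
  rw [← range_eq_univ, ← univ_subset_iff, ← h.dense_compl.closure_eq]
  exact closure_minimal (hsub.trans (image_subset_range _ _)) hcl

theorem isOpenMap (h : IsDiffeoOff f B) : IsOpenMap f := by
  rw [isOpenMap_iff_nhds_le]
  intro x
  by_cases hx : x ∈ B
  · intro s hs
    obtain ⟨ε, hε, hball⟩ := Metric.mem_nhds_iff.1 (mem_map.1 hs)
    -- Surjectivity and expansion together show that the ball of radius `ε` about `f x` lies in the
    -- image of the ball of radius `ε` about `x`.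
    refine Metric.mem_nhds_iff.2 ⟨ε, hε, fun y hy => ?_⟩
    obtain ⟨z, rfl⟩ := h.surjective y
    exact hball ((h.dist_le x hx z).trans_lt hy)
  · obtain ⟨e, hxe, rfl⟩ := h.exists_openPartialHomeomorph hx
    exact (e.map_nhds_eq hxe).ge

/-- On a ball where `f` is injective, this is the change of variables formula with positive
Jacobian. -/
theorem hasLocalIndex_one (h : IsDiffeoOff f B) {x : EuclideanSpace ℝ (Fin n)} (hx : x ∉ B) :
    HasLocalIndex f x 1 := by
  obtain ⟨e, hxe, hfe⟩ := h.exists_openPartialHomeomorph hx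
  obtain ⟨r, hr, hsub⟩ := Metric.nhds_basis_closedBall.mem_iff.1
    ((e.open_source.inter h.isClosed.isOpen_compl).mem_nhds ⟨hxe, hx⟩)
  have hinj : InjOn f (Metric.closedBall x r) := by
    rw [hfe]
    exact e.injOn.mono (hsub.trans inter_subset_left)
  have hxr : x ∈ Metric.closedBall x r := Metric.mem_closedBall_self hr.le
  refine ⟨r, hr, fun z hz hzx => hinj hz hxr hzx, fun ρ hρ hρr => ?_⟩
  obtain ⟨L, hL⟩ := h.lipschitz
  have hball : Metric.ball x ρ ⊆ Metric.closedBall x r :=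
    (Metric.ball_subset_ball hρr).trans Metric.ball_subset_closedBall
  refine ⟨hL.locallyLipschitz, Metric.isOpen_ball, Metric.isBounded_ball, ?_, ?_⟩
  · rintro ⟨z, hz, hzx⟩
    have hz' : z ∈ Metric.closedBall x r :=
      Metric.closedBall_subset_closedBall hρr (Metric.closure_ball_subset_closedBall hz.1)
    obtain rfl := hinj hz' hxr hzx
    rw [Metric.isOpen_ball.frontier_eq] at hz
    exact hz.2 (Metric.mem_ball_self hρ)
  · obtain ⟨ε, hε, hεsub⟩ := Metric.isOpen_iff.1 (h.isOpen_image Metric.isOpen_ball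
      (hball.trans (hsub.trans inter_subset_right))) (f x)
      (mem_image_of_mem f (Metric.mem_ball_self hρ))
    refine ⟨ε, hε, fun φ _ hφ => ?_⟩
    have hnB : ∀ z ∈ Metric.ball x ρ, z ∉ B := fun z hz => (hsub (hball hz)).2
    have key := integral_image_eq_integral_abs_det_fderiv_smul volume
      (measurableSet_ball (x := x) (ε := ρ))
      (fun z hz => (h.hasStrictFDerivAt z (hnB z hz)).hasFDerivAt.hasFDerivWithinAt)
      (hinj.mono hball) φ
    rw [setIntegral_eq_integral_of_forall_compl_eq_zero (fun z hz => by
      by_contra hne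
      exact hz (hεsub (hφ (subset_tsupport _ hne))))] at key
    rw [Int.cast_one, one_mul, key]
    refine setIntegral_congr_fun measurableSet_ball fun z hz => ?_
    simp only [smul_eq_mul, abs_of_pos (h.det_pos z (hnB z hz)), mul_comm]

/-- The measure with density the Jacobian. -/
noncomputable def jacobianMeasure (f : EuclideanSpace ℝ (Fin n) → EuclideanSpace ℝ (Fin n)) :
    Measure (EuclideanSpace ℝ (Fin n)) :=
  volume.withDensity fun x => ENNReal.ofReal |(fderiv ℝ f x).det|

theorem measurable_jacobian (f : EuclideanSpace ℝ (Fin n) → EuclideanSpace ℝ (Fin n)) :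
    Measurable fun x => ENNReal.ofReal |(fderiv ℝ f x).det| :=
  (ContinuousLinearMap.continuous_det.measurable.comp (measurable_fderiv ℝ f)).abs.ennreal_ofReal

theorem jacobianMeasure_inter_preimage (h : IsDiffeoOff f B)
    {U A : Set (EuclideanSpace ℝ (Fin n))} (hU : IsOpen U) (hUB : U ⊆ Bᶜ) (hinj : InjOn f U)
    (hA : MeasurableSet A) (hAU : A ⊆ f '' U) :
    jacobianMeasure f (U ∩ f ⁻¹' A) = volume A := by
  have hm : MeasurableSet (U ∩ f ⁻¹' A) :=
    hU.measurableSet.inter (h.continuous.measurable hA)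
  rw [jacobianMeasure, withDensity_apply _ hm, lintegral_abs_det_fderiv_eq_addHaar_image volume hm
    (fun x hx => (h.hasStrictFDerivAt x (hUB hx.1)).hasFDerivAt.hasFDerivWithinAt)
    (hinj.mono inter_subset_left), image_inter_preimage, inter_eq_right.2 hAU]

theorem exists_isOpen_map_jacobianMeasure (h : IsDiffeoOff f B)
    {y : EuclideanSpace ℝ (Fin n)} (hy : y ∉ B) :
    ∃ W, IsOpen W ∧ y ∈ W ∧ ∀ A ⊆ W, MeasurableSet A →
      Measure.map f (jacobianMeasure f) A = (f ⁻¹' {y}).ncard * volume A := by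
  obtain ⟨F, hF⟩ := (h.finite_fiber y).exists_finset_coe
  have hFy : ∀ x, x ∈ F ↔ f x = y := fun x => by rw [← Finset.mem_coe, hF]; rfl
  obtain ⟨U, hU, hUd⟩ := F.finite_toSet.t2_separation
  have hloc : ∀ x ∈ F, ∃ V, IsOpen V ∧ x ∈ V ∧ V ⊆ U x ∧ V ⊆ Bᶜ ∧ InjOn f V := by
    intro x hx
    have hxB : x ∉ B := fun hxB => hy (by rw [← (hFy x).1 hx]; exact (h.mem_iff x).2 hxB)
    obtain ⟨e, hxe, rfl⟩ := h.exists_openPartialHomeomorph hxB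
    exact ⟨e.source ∩ Bᶜ ∩ U x, (e.open_source.inter h.isClosed.isOpen_compl).inter (hU x).2,
      ⟨⟨hxe, hxB⟩, (hU x).1⟩, inter_subset_right, fun z hz => hz.1.2,
      e.injOn.mono fun z hz => hz.1.1⟩
  choose! V hVo hxV hVU hVB hVinj using hloc
  have hUo : IsOpen (⋃ x ∈ F, V x) := isOpen_biUnion hVo
  -- An evenly covered neighbourhood: its points have a preimage in every `V x` and none outside
  -- their union. It is open because `f` is a closed map.
  refine ⟨(⋂ x ∈ F, f '' V x) ∩ (f '' (⋃ x ∈ F, V x)ᶜ)ᶜ, ?_, ⟨?_, ?_⟩, fun A hA hAm => ?_⟩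
  · exact (isOpen_biInter_finset fun x hx => h.isOpen_image (hVo x hx) (hVB x hx)).inter
      (h.isClosedMap _ hUo.isClosed_compl).isOpen_compl
  · exact mem_iInter₂.2 fun x hx => ⟨x, hxV x hx, (hFy x).1 hx⟩
  · rintro ⟨x, hx, hxy⟩
    exact hx (mem_biUnion ((hFy x).2 hxy) (hxV x ((hFy x).2 hxy)))
  · have hpre : f ⁻¹' A = ⋃ x ∈ F, V x ∩ f ⁻¹' A := by
      rw [← iUnion₂_inter, eq_comm, inter_eq_right]
      intro x hx
      by_contra hxV
      exact (hA hx).2 ⟨x, hxV, rfl⟩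
    rw [Measure.map_apply h.continuous.measurable hAm, hpre, measure_biUnion_finset
      (fun x hx z hz hxz => (hUd hx hz hxz).mono (inter_subset_left.trans (hVU x hx))
        (inter_subset_left.trans (hVU z hz)))
      (fun x hx => (hVo x hx).measurableSet.inter (h.continuous.measurable hAm)),
      Finset.sum_congr rfl fun x hx => h.jacobianMeasure_inter_preimage (hVo x hx) (hVB x hx)
        (hVinj x hx) hAm (hA.trans (inter_subset_left.trans (biInter_subset_of_mem hx))),
      Finset.sum_const, nsmul_eq_mul, ← hF, ncard_coe_finset]

/-- Local constancy is read off from measures: on a small open set of positive finite volume, the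
pushforward of the Jacobian measure is volume times either cardinality. -/
theorem ncard_fiber_eq (h : IsDiffeoOff f B) {y z : EuclideanSpace ℝ (Fin n)} (hy : y ∉ B)
    (hz : z ∉ B) : (f ⁻¹' {y}).ncard = (f ⁻¹' {z}).ncard := by
  refine h.preconnected.constant (f := fun y => (f ⁻¹' {y}).ncard) (fun y hy => ?_) hy hz
  refine ContinuousAt.continuousWithinAt
    (continuousAt_const.congr (f := fun _ => (f ⁻¹' {y}).ncard) ?_)
  obtain ⟨W, hWo, hyW, hW⟩ := h.exists_isOpen_map_jacobianMeasure hy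
  filter_upwards [hWo.mem_nhds hyW, h.isClosed.isOpen_compl.mem_nhds hy] with w hwW hwB
  obtain ⟨W', hWo', hwW', hW'⟩ := h.exists_isOpen_map_jacobianMeasure hwB
  set A := W ∩ W' ∩ Metric.ball w 1 with hA
  have hAo : IsOpen A := (hWo.inter hWo').inter Metric.isOpen_ball
  have h₁ := hW A (fun _ hx => hx.1.1) hAo.measurableSet
  have h₂ := hW' A (fun _ hx => hx.1.2) hAo.measurableSet
  rw [h₁] at h₂
  have hpos : volume A ≠ 0 :=
    (hAo.measure_pos volume ⟨w, ⟨hwW, hwW'⟩, Metric.mem_ball_self one_pos⟩).ne'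
  have hfin : volume A ≠ ⊤ := ((measure_mono inter_subset_right).trans_lt measure_ball_lt_top).ne
  exact_mod_cast (ENNReal.mul_left_inj hpos hfin).1 h₂

/-- Off `B` the two measures agree locally, hence on a countable cover. On `B` both vanish, since `f
⁻¹' B = B` is null. -/
theorem map_jacobianMeasure (h : IsDiffeoOff f B) {y : EuclideanSpace ℝ (Fin n)} (hy : y ∉ B) :
    Measure.map f (jacobianMeasure f) = (f ⁻¹' {y}).ncard • volume := by
  set N := (f ⁻¹' {y}).ncard with hN
  have hloc : ∀ z ∈ Bᶜ, ∃ W ∈ 𝓝[Bᶜ] z,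
      (Measure.map f (jacobianMeasure f)).restrict W = (N • volume : Measure _).restrict W := by
    intro z hz
    obtain ⟨W, hWo, hzW, hW⟩ := h.exists_isOpen_map_jacobianMeasure hz
    refine ⟨W, mem_nhdsWithin_of_mem_nhds (hWo.mem_nhds hzW), ?_⟩
    ext A hA
    rw [Measure.restrict_apply hA, Measure.restrict_apply hA,
      hW _ inter_subset_right (hA.inter hWo.measurableSet), h.ncard_fiber_eq hz hy]
    simp [hN]
  choose! W hWn hW using hloc
  obtain ⟨t, htB, htc, ht⟩ := TopologicalSpace.countable_cover_nhdsWithin hWn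
  have hoff : (Measure.map f (jacobianMeasure f)).restrict Bᶜ
      = (N • volume : Measure _).restrict Bᶜ :=
    Measure.restrict_congr_mono ht
      ((Measure.restrict_biUnion_congr htc).2 fun z hz => hW z (htB hz))
  have hpre : f ⁻¹' B = B := ext h.mem_iff
  have hB₁ : ∀ᵐ x ∂Measure.map f (jacobianMeasure f), x ∈ Bᶜ := by
    refine compl_mem_ae_iff.2 ?_
    rw [Measure.map_apply h.continuous.measurable h.isClosed.measurableSet, hpre]
    exact withDensity_absolutelyContinuous _ _ h.null
  have hB₂ : ∀ᵐ x ∂(N • volume : Measure (EuclideanSpace ℝ (Fin n))), x ∈ Bᶜ :=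
    compl_mem_ae_iff.2 (by simp [h.null])
  rwa [Measure.restrict_eq_self_of_ae_mem hB₁, Measure.restrict_eq_self_of_ae_mem hB₂] at hoff

theorem integral_comp_mul_det_fderiv (h : IsDiffeoOff f B) {y : EuclideanSpace ℝ (Fin n)}
    (hy : y ∉ B) {φ : EuclideanSpace ℝ (Fin n) → ℝ} (hφ : Continuous φ) :
    ∫ x, φ (f x) * (fderiv ℝ f x).det = (f ⁻¹' {y}).ncard * ∫ z, φ z := by
  have key : ∫ z, φ z ∂(Measure.map f (jacobianMeasure f)) = ∫ x, φ (f x) ∂(jacobianMeasure f) :=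
    integral_map h.continuous.aemeasurable hφ.aestronglyMeasurable
  rw [h.map_jacobianMeasure hy, ← Nat.cast_smul_eq_nsmul ℝ≥0, integral_smul_nnreal_measure,
    jacobianMeasure, integral_withDensity_eq_integral_toReal_smul (measurable_jacobian f)
      (Eventually.of_forall fun _ => ENNReal.ofReal_lt_top)] at key
  rw [NNReal.smul_def, smul_eq_mul, NNReal.coe_natCast] at key
  rw [key]
  refine integral_congr_ae ?_
  filter_upwards [compl_mem_ae_iff.2 h.null] with x hx
  rw [ENNReal.toReal_ofReal (abs_nonneg _), abs_of_pos (h.det_pos x hx), smul_eq_mul, mul_comm]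

/-- By expansion, if `φ` is supported in the `ρ`-ball about `f b`, then `φ ∘ f` vanishes outside the
`ρ`-ball about `b`. The local integral is thus the global one, for every `ρ`; the radius 1 below is
arbitrary. -/
theorem hasLocalIndex_ncard_fiber (h : IsDiffeoOff f B) {b : EuclideanSpace ℝ (Fin n)}
    (hb : b ∈ B) {y : EuclideanSpace ℝ (Fin n)} (hy : y ∉ B) :
    HasLocalIndex f b (f ⁻¹' {y}).ncard := by
  obtain ⟨L, hL⟩ := h.lipschitz
  have heq : ∀ z, f z = f b → z = b := fun z hz => by
    simpa [hz] using h.dist_le b hb z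
  refine ⟨1, one_pos, fun z _ => heq z, fun ρ hρ _ => ⟨hL.locallyLipschitz, Metric.isOpen_ball,
    Metric.isBounded_ball, ?_, ρ, hρ, fun φ hφ hsupp => ?_⟩⟩
  · rintro ⟨z, hz, hzb⟩
    obtain rfl := heq z hzb
    rw [Metric.isOpen_ball.frontier_eq] at hz
    exact hz.2 (Metric.mem_ball_self hρ)
  · rw [Int.cast_natCast, ← h.integral_comp_mul_det_fderiv hy hφ]
    refine setIntegral_eq_integral_of_forall_compl_eq_zero fun x hx => ?_
    have : φ (f x) = 0 := by
      by_contra hne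
      exact hx ((h.dist_le b hb x).trans_lt (hsupp (subset_tsupport _ hne)))
    rw [this, zero_mul]

theorem isSensePreserving (h : IsDiffeoOff f B) : IsSensePreserving f := by
  intro D hDo _ hDb y hy
  obtain ⟨L, hL⟩ := h.lipschitz
  obtain ⟨F, hF⟩ := ((h.finite_fiber y).inter_of_right D).exists_finset_coe
  have hFy : ∀ x, x ∈ F ↔ x ∈ D ∧ f x = y := fun x => by rw [← Finset.mem_coe, hF]; rfl
  have hidx : ∀ x, ∃ d : ℤ, 0 < d ∧ HasLocalIndex f x d := by
    intro x
    by_cases hx : x ∈ B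
    · obtain ⟨w, hw⟩ := h.dense_compl.nonempty
      refine ⟨_, ?_, h.hasLocalIndex_ncard_fiber hx hw⟩
      exact_mod_cast (ncard_pos (h.finite_fiber w)).2 (h.surjective w)
    · exact ⟨1, one_pos, h.hasLocalIndex_one hx⟩
  choose i hi hidx using hidx
  refine ⟨_, Finset.sum_pos (fun x _ => hi x) ?_,
    hL.hasDegree_sum_of_hasLocalIndex hDo hDb hy.2 hFy fun x _ => hidx x⟩
  obtain ⟨x, hx⟩ := hy.1
  exact ⟨x, (hFy x).2 hx⟩

theorem isBLD (h : IsDiffeoOff f B) : IsBLD f := by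
  obtain ⟨L, hL⟩ := h.lipschitz
  obtain ⟨C, hC⟩ := h.exists_eventually_edist_le
  refine ⟨h.continuous, h.discreteTopology_fiber, h.isOpenMap, h.isSensePreserving,
    max 1 (max L C), le_max_left _ _, fun a b α _ hα => ⟨?_, ?_⟩⟩
  · refine eVariationOn_le_mul_eVariationOn fun t ht => ?_
    filter_upwards [(hα t ht).eventually (hC (α t))] with s hs
    refine hs.trans (mul_le_mul_left ?_ _)
    exact_mod_cast (le_max_right L C).trans (le_max_right _ _)
  · refine eVariationOn_le_mul_eVariationOn fun t _ => Eventually.of_forall fun s => ?_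
    refine (hL (α s) (α t)).trans (mul_le_mul_left ?_ _)
    exact_mod_cast (le_max_left L C).trans (le_max_right _ _)

theorem branchSet_eq (h : IsDiffeoOff f B) (hB : ∀ b ∈ B, ∀ ε > 0, ¬ InjOn f (Metric.ball b ε)) :
    branchSet f = B := by
  ext x
  refine ⟨fun hx => ?_, fun hx hloc => ?_⟩
  · by_contra hxB
    refine hx ?_
    rintro _ rfl
    exact h.exists_openPartialHomeomorph hxB
  · obtain ⟨e, hxe, rfl⟩ := hloc x rfl
    obtain ⟨ε, hε, hsub⟩ := Metric.isOpen_iff.1 e.open_source x hxe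
    exact hB x hx ε hε (e.injOn.mono hsub)

end IsDiffeoOff

/-! ### The planar part -/

/-- Half of the first partial derivative of `(p, q) ↦ p² q² / (p² + q²)`. -/
noncomputable def quinticQuotient (p q : ℝ) : ℝ := p * q ^ 4 / (p ^ 2 + q ^ 2) ^ 2

/-- The partial derivative of `quinticQuotient` in the first variable. -/
noncomputable def quinticQuotientFst (p q : ℝ) : ℝ :=
  q ^ 4 * (q ^ 2 - 3 * p ^ 2) / (p ^ 2 + q ^ 2) ^ 3

/-- The partial derivative of `quinticQuotient` in the second variable. -/
noncomputable def quinticQuotientSnd (p q : ℝ) : ℝ := 4 * (p ^ 3 * q ^ 3) / (p ^ 2 + q ^ 2) ^ 3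

theorem quinticQuotientSnd_comm (p q : ℝ) : quinticQuotientSnd p q = quinticQuotientSnd q p := by
  unfold quinticQuotientSnd
  ring

theorem quinticQuotient_mul (s p q : ℝ) :
    quinticQuotient (s * p) (s * q) = s * quinticQuotient p q := by
  unfold quinticQuotient
  rcases eq_or_ne s 0 with rfl | hs
  · simp
  · rw [show (s * p) * (s * q) ^ 4 = s ^ 4 * (s * (p * q ^ 4)) by ring,
      show ((s * p) ^ 2 + (s * q) ^ 2) ^ 2 = s ^ 4 * (p ^ 2 + q ^ 2) ^ 2 by ring,
      mul_div_mul_left _ _ (pow_ne_zero 4 hs), mul_div_assoc]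

theorem abs_quinticQuotient_le (p q : ℝ) : |quinticQuotient p q| ≤ |p| := by
  unfold quinticQuotient
  rw [abs_div, abs_of_nonneg (by positivity : 0 ≤ (p ^ 2 + q ^ 2) ^ 2)]
  refine div_le_of_le_mul₀ (by positivity) (abs_nonneg _) ?_
  rw [abs_mul, abs_of_nonneg (by positivity : 0 ≤ q ^ 4)]
  gcongr
  nlinarith [sq_nonneg p, sq_nonneg q, mul_nonneg (sq_nonneg p) (sq_nonneg q), sq_nonneg (p ^ 2)]

theorem abs_quinticQuotientFst_le (p q : ℝ) : |quinticQuotientFst p q| ≤ 3 := by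
  unfold quinticQuotientFst
  have hp := sq_nonneg p
  have hq := sq_nonneg q
  rw [abs_div, abs_of_nonneg (by positivity : 0 ≤ (p ^ 2 + q ^ 2) ^ 3)]
  refine div_le_of_le_mul₀ (by positivity) (by norm_num) ?_
  rw [abs_mul, abs_of_nonneg (by positivity : 0 ≤ q ^ 4)]
  have h₁ : |q ^ 2 - 3 * p ^ 2| ≤ 3 * (p ^ 2 + q ^ 2) := by
    rw [abs_le]
    constructor <;> linarith
  have h₂ : q ^ 4 ≤ (p ^ 2 + q ^ 2) ^ 2 := by nlinarith [mul_nonneg hp hq, sq_nonneg (p ^ 2)]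
  calc q ^ 4 * |q ^ 2 - 3 * p ^ 2| ≤ (p ^ 2 + q ^ 2) ^ 2 * (3 * (p ^ 2 + q ^ 2)) := by gcongr
    _ = _ := by ring

theorem abs_quinticQuotientSnd_le (p q : ℝ) : |quinticQuotientSnd p q| ≤ 4 := by
  unfold quinticQuotientSnd
  have hp := sq_nonneg p
  have hq := sq_nonneg q
  rw [abs_div, abs_of_nonneg (by positivity : 0 ≤ (p ^ 2 + q ^ 2) ^ 3)]
  refine div_le_of_le_mul₀ (by positivity) (by norm_num) ?_
  have h₁ : |p * q| ≤ p ^ 2 + q ^ 2 := by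
    rw [abs_le]
    constructor <;> nlinarith [sq_nonneg (p + q), sq_nonneg (p - q)]
  rw [abs_mul, ← mul_pow, abs_pow, abs_of_pos (by norm_num : (0 : ℝ) < 4)]
  gcongr

/-- The planar map `(p, q) ↦ (p - 8 p q⁴ / (p² + q²)², q - 8 p⁴ q / (p² + q²)²)` does not decrease
the norm. -/
theorem sq_add_sq_le_of_quinticQuotient (p q : ℝ) :
    p ^ 2 + q ^ 2 ≤ (p - 8 * quinticQuotient p q) ^ 2 + (q - 8 * quinticQuotient q p) ^ 2 := by
  rcases eq_or_ne (p ^ 2 + q ^ 2) 0 with h | h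
  · rw [h]
    positivity
  · have h' : 0 < p ^ 2 + q ^ 2 := lt_of_le_of_ne (by positivity) h.symm
    -- The added term is `3 ρ² sin² 4θ`.
    have key : (p - 8 * quinticQuotient p q) ^ 2 + (q - 8 * quinticQuotient q p) ^ 2
        = p ^ 2 + q ^ 2 + 48 * (p ^ 2 * q ^ 2) * (p ^ 2 - q ^ 2) ^ 2 / (p ^ 2 + q ^ 2) ^ 3 := by
      unfold quinticQuotient
      rw [add_comm (q ^ 2) (p ^ 2)]
      field_simp
      ring
    rw [key]
    have : 0 ≤ 48 * (p ^ 2 * q ^ 2) * (p ^ 2 - q ^ 2) ^ 2 / (p ^ 2 + q ^ 2) ^ 3 := by positivity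
    linarith

/-- The left side is `-4 - 3 cos² 4θ`, where `p² q² / (p² + q²)² = (1 - cos 4θ) / 8`. -/
theorem det_quinticQuotient_le {p q : ℝ} (h : p ^ 2 + q ^ 2 ≠ 0) :
    (1 - 8 * quinticQuotientFst p q) * (1 - 8 * quinticQuotientFst q p)
      - 64 * (quinticQuotientSnd p q * quinticQuotientSnd q p) ≤ -4 := by
  have h' : 0 < p ^ 2 + q ^ 2 := lt_of_le_of_ne (by positivity) h.symm
  have key : (1 - 8 * quinticQuotientFst p q) * (1 - 8 * quinticQuotientFst q p)
      - 64 * (quinticQuotientSnd p q * quinticQuotientSnd q p)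
      = -4 - 192 * (p ^ 2 * q ^ 2 / (p ^ 2 + q ^ 2) ^ 2 - 1 / 8) ^ 2 := by
    unfold quinticQuotientFst quinticQuotientSnd
    rw [add_comm (q ^ 2) (p ^ 2)]
    field_simp
    ring
  rw [key]
  nlinarith [sq_nonneg (p ^ 2 * q ^ 2 / (p ^ 2 + q ^ 2) ^ 2 - 1 / 8)]

/-- The inverse of a symmetric `2 × 2` matrix with bounded entries and determinant bounded away
from zero is bounded. -/
theorem sq_add_sq_le_of_det {a b c v w : ℝ} (ha : |a| ≤ 25) (hb : |b| ≤ 32) (hc : |c| ≤ 25)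
    (hdet : a * c - b * b ≤ -4) :
    v ^ 2 + w ^ 2 ≤ 225 * ((a * v + b * w) ^ 2 + (b * v + c * w) ^ 2) := by
  set s := a * v + b * w with hs
  set t := b * v + c * w with ht
  -- Cramer's rule. The sum of squares of the entries is at most `3298 ≤ 3600`, the squared
  -- determinant is at least 16, and `3600 / 16 = 225`.
  have hv : (a * c - b * b) * v = c * s - b * t := by rw [hs, ht]; ring
  have hw : (a * c - b * b) * w = a * t - b * s := by rw [hs, ht]; ring
  have hD : 16 ≤ (a * c - b * b) ^ 2 := by nlinarith
  have ha' : a ^ 2 ≤ 625 := by nlinarith [sq_abs a, abs_nonneg a]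
  have hb' : b ^ 2 ≤ 1024 := by nlinarith [sq_abs b, abs_nonneg b]
  have hc' : c ^ 2 ≤ 625 := by nlinarith [sq_abs c, abs_nonneg c]
  have h₁ : (c * s - b * t) ^ 2 ≤ (c ^ 2 + b ^ 2) * (s ^ 2 + t ^ 2) := by
    nlinarith [sq_nonneg (c * t + b * s)]
  have h₂ : (a * t - b * s) ^ 2 ≤ (a ^ 2 + b ^ 2) * (s ^ 2 + t ^ 2) := by
    nlinarith [sq_nonneg (a * s + b * t)]
  have h₃ : (a * c - b * b) ^ 2 * (v ^ 2 + w ^ 2)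
      ≤ (c ^ 2 + b ^ 2 + (a ^ 2 + b ^ 2)) * (s ^ 2 + t ^ 2) := by
    rw [← hv] at h₁
    rw [← hw] at h₂
    linarith [mul_pow (a * c - b * b) v 2, mul_pow (a * c - b * b) w 2]
  have h₄ : (c ^ 2 + b ^ 2 + (a ^ 2 + b ^ 2)) * (s ^ 2 + t ^ 2) ≤ 3600 * (s ^ 2 + t ^ 2) := by
    gcongr
    linarith
  have h₅ : 16 * (v ^ 2 + w ^ 2) ≤ (a * c - b * b) ^ 2 * (v ^ 2 + w ^ 2) := by gcongr
  linarith

/-- The planar map takes the value `(1, 0)` at exactly three points. -/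
theorem exists_quinticQuotient_fiber :
    ∃ p₀ q₀ : ℝ, q₀ ≠ 0 ∧ ∀ p q : ℝ,
      (p - 8 * quinticQuotient p q = 1 ∧ q - 8 * quinticQuotient q p = 0) ↔
        (p = 1 ∧ q = 0) ∨ (p = p₀ ∧ q = q₀) ∨ (p = p₀ ∧ q = -q₀) := by
  -- For `q ≠ 0` the second equation says `(p² + q²)² = 8 p⁴`, so `q² = t p²` with `t = 2√2 - 1`.
  -- The first then reads `p (1 - t²) = 1`.
  set r := √2 with hr
  have hr2 : r ^ 2 = 2 := Real.sq_sqrt (by norm_num)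
  have hr1 : 1 < r := by nlinarith [Real.sqrt_nonneg 2]
  set t := 2 * r - 1 with ht
  have ht1 : 1 < t := by linarith
  have ht2 : 1 - t ^ 2 ≠ 0 := by nlinarith
  have htr : (1 + t) ^ 2 = 8 := by rw [ht]; nlinarith
  have hst : √t ^ 2 = t := Real.sq_sqrt (by linarith)
  have hst0 : √t ≠ 0 := (Real.sqrt_pos.2 (by linarith)).ne'
  set P := (1 - t ^ 2)⁻¹ with hP
  have hP0 : P ≠ 0 := inv_ne_zero ht2
  have hPt : P * (1 - t ^ 2) = 1 := inv_mul_cancel₀ ht2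
  have hval : ∀ q, q ^ 2 = t * P ^ 2 →
      P - 8 * quinticQuotient P q = 1 ∧ q - 8 * quinticQuotient q P = 0 := by
    intro q hq
    have h₁ : (P ^ 2 + q ^ 2) ^ 2 = 8 * P ^ 4 := by
      rw [hq, ← htr]
      ring
    have h₂ : q ^ 4 = t ^ 2 * P ^ 4 := by
      rw [show q ^ 4 = (q ^ 2) ^ 2 by ring, hq]
      ring
    unfold quinticQuotient
    rw [add_comm (q ^ 2), h₁, h₂]
    constructor
    · rw [← hPt]
      field_simp
    · field_simp
      ring
  refine ⟨P, √t * P, mul_ne_zero hst0 hP0, fun p q => ⟨?_, ?_⟩⟩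
  · rintro ⟨h₁, h₂⟩
    have hρ : p ^ 2 + q ^ 2 ≠ 0 := by
      intro h0
      have hp : p = 0 := by nlinarith [sq_nonneg p, sq_nonneg q]
      rw [hp] at h₁
      simp [quinticQuotient] at h₁
    unfold quinticQuotient at h₁ h₂
    rw [add_comm (q ^ 2)] at h₂
    field_simp at h₁ h₂
    rw [mul_zero] at h₂
    rcases mul_eq_zero.1 h₂ with hq | hq
    · left
      subst hq
      have hp : p ≠ 0 := by simpa using hρ
      refine ⟨?_, rfl⟩
      have : p ^ 4 * (p - 1) = 0 := by linear_combination h₁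
      rcases mul_eq_zero.1 this with h | h
      · exact absurd h (pow_ne_zero 4 hp)
      · linarith
    · right
      have hsum : p ^ 2 + q ^ 2 = 2 * r * p ^ 2 := by
        have hfac : (p ^ 2 + q ^ 2 - 2 * r * p ^ 2) * (p ^ 2 + q ^ 2 + 2 * r * p ^ 2) = 0 := by
          linear_combination hq - 4 * p ^ 4 * hr2
        rcases mul_eq_zero.1 hfac with h | h
        · linarith
        · have := lt_of_le_of_ne (by positivity) hρ.symm
          nlinarith [mul_nonneg (by linarith : 0 ≤ 2 * r) (sq_nonneg p)]
      have hq2 : q ^ 2 = t * p ^ 2 := by rw [ht]; linarith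
      have hp : p ≠ 0 := by
        rintro rfl
        simp [hq2] at hρ
      have hpP : p = P := by
        have h₃ : p ^ 4 * (p * (1 - t ^ 2) - 1) = 0 := by
          have hq4 : q ^ 4 = t ^ 2 * p ^ 4 := by
            rw [show q ^ 4 = (q ^ 2) ^ 2 by ring, hq2]
            ring
          have h8 : (p ^ 2 + q ^ 2) ^ 2 = 8 * p ^ 4 := by linarith
          rw [h8, hq4] at h₁
          linear_combination h₁ / 8
        rcases mul_eq_zero.1 h₃ with h | h
        · exact absurd h (pow_ne_zero 4 hp)
        · refine eq_inv_of_mul_eq_one_left ?_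
          linarith
      have : q ^ 2 = (√t * P) ^ 2 := by rw [mul_pow, hst, hq2, hpP]
      rcases sq_eq_sq_iff_eq_or_eq_neg.1 this with h | h
      · exact Or.inl ⟨hpP, h⟩
      · exact Or.inr ⟨hpP, h⟩
  · rintro (⟨rfl, rfl⟩ | ⟨rfl, rfl⟩ | ⟨rfl, rfl⟩)
    · simp [quinticQuotient]
    · exact hval _ (by rw [mul_pow, hst])
    · exact hval _ (by rw [neg_sq, mul_pow, hst])

/-! ### The potential and its gradient -/

section Saddle

variable {n : ℕ}

/-- The potential `½ |x|² - x_k² - 4 x_i² x_j² / (x_i² + x_j²)`. -/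
noncomputable def saddlePotential (i j k : Fin n) (x : EuclideanSpace ℝ (Fin n)) : ℝ :=
  ‖x‖ ^ 2 / 2 - x k ^ 2 - 4 * (x i ^ 2 * x j ^ 2 / (x i ^ 2 + x j ^ 2))

/-- `x - c e_k - a e_i - b e_j`. -/
noncomputable def subAxes (i j k : Fin n) (x : EuclideanSpace ℝ (Fin n)) (c a b : ℝ) :
    EuclideanSpace ℝ (Fin n) :=
  x - c • EuclideanSpace.single k 1 - a • EuclideanSpace.single i 1
    - b • EuclideanSpace.single j 1

/-- The gradient of `saddlePotential`. -/
noncomputable def saddleGradient (i j k : Fin n) (x : EuclideanSpace ℝ (Fin n)) :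
    EuclideanSpace ℝ (Fin n) :=
  subAxes i j k x (2 * x k) (8 * quinticQuotient (x i) (x j)) (8 * quinticQuotient (x j) (x i))

/-- The coordinate subspace `x_i = x_j = 0`. -/
noncomputable def axisSubspace (i j : Fin n) : Submodule ℝ (EuclideanSpace ℝ (Fin n)) :=
  LinearMap.ker ((EuclideanSpace.proj (𝕜 := ℝ) i).toLinearMap.prod
    (EuclideanSpace.proj (𝕜 := ℝ) j).toLinearMap)

theorem mem_axisSubspace {i j : Fin n} {x : EuclideanSpace ℝ (Fin n)} :
    x ∈ axisSubspace i j ↔ x i = 0 ∧ x j = 0 := by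
  simp [axisSubspace]

theorem sq_add_sq_ne_zero_of_notMem {i j : Fin n} {x : EuclideanSpace ℝ (Fin n)}
    (hx : x ∉ axisSubspace i j) : x i ^ 2 + x j ^ 2 ≠ 0 := by
  intro h
  refine hx (mem_axisSubspace.2 ⟨?_, ?_⟩) <;> nlinarith [sq_nonneg (x i), sq_nonneg (x j)]

theorem saddlePotential_smul (i j k : Fin n) (t : ℝ) (x : EuclideanSpace ℝ (Fin n)) :
    saddlePotential i j k (t • x) = t ^ 2 * saddlePotential i j k x := by
  simp only [saddlePotential, norm_smul, PiLp.smul_apply, smul_eq_mul, mul_pow, Real.norm_eq_abs,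
    sq_abs]
  rcases eq_or_ne t 0 with rfl | ht
  · simp
  · rw [← mul_add, mul_mul_mul_comm, ← sq, sq (t ^ 2), mul_assoc,
      mul_div_mul_left _ _ (pow_ne_zero 2 ht)]
    ring

section Coordinates

variable {i j k : Fin n} (x : EuclideanSpace ℝ (Fin n)) (c a b : ℝ)

theorem subAxes_apply_of_ne {l : Fin n} (hi : l ≠ i) (hj : l ≠ j) (hk : l ≠ k) :
    subAxes i j k x c a b l = x l := by
  simp [subAxes, hi, hj, hk]

theorem subAxes_apply_fst (hij : i ≠ j) (hik : i ≠ k) : subAxes i j k x c a b i = x i - a := by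
  simp [subAxes, hij, hik]

theorem subAxes_apply_snd (hij : i ≠ j) (hjk : j ≠ k) : subAxes i j k x c a b j = x j - b := by
  simp [subAxes, hij.symm, hjk]

theorem subAxes_apply_third (hik : i ≠ k) (hjk : j ≠ k) : subAxes i j k x c a b k = x k - c := by
  simp [subAxes, hik.symm, hjk.symm]

theorem norm_subAxes_sq (hij : i ≠ j) (hik : i ≠ k) (hjk : j ≠ k) : ‖subAxes i j k x c a b‖ ^ 2
    = ‖x‖ ^ 2 + (c ^ 2 - 2 * c * x k) + ((x i - a) ^ 2 - x i ^ 2) + ((x j - b) ^ 2 - x j ^ 2) := by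
  rw [subAxes, norm_sub_sq_real, norm_sub_sq_real, norm_sub_sq_real]
  simp [inner_sub_left, inner_smul_left, inner_smul_right, EuclideanSpace.inner_single_right,
    norm_smul, hik, hjk, hij.symm]
  ring

theorem norm_subAxes_le : ‖subAxes i j k x c a b‖ ≤ ‖x‖ + |c| + |a| + |b| := by
  unfold subAxes
  refine (norm_sub_le _ _).trans (add_le_add ((norm_sub_le _ _).trans
    (add_le_add ((norm_sub_le _ _).trans (add_le_add le_rfl ?_)) ?_)) ?_) <;> simp [norm_smul]

theorem inner_subAxes (v : EuclideanSpace ℝ (Fin n)) :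
    inner ℝ (subAxes i j k x c a b) v = inner ℝ x v - c * v k - a * v i - b * v j := by
  simp [subAxes, inner_sub_left, inner_smul_left, EuclideanSpace.inner_single_left]

end Coordinates

theorem abs_apply_le_norm (x : EuclideanSpace ℝ (Fin n)) (l : Fin n) : |x l| ≤ ‖x‖ :=
  PiLp.norm_apply_le x l

/-! ### Derivatives -/

theorem hasStrictFDerivAt_quinticQuotient {E : Type*} [NormedAddCommGroup E] [NormedSpace ℝ E]
    (u w : E →L[ℝ] ℝ) {x : E} (h : u x ^ 2 + w x ^ 2 ≠ 0) :
    HasStrictFDerivAt (fun y => quinticQuotient (u y) (w y))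
      (quinticQuotientFst (u x) (w x) • u + quinticQuotientSnd (u x) (w x) • w) x := by
  have hu := u.hasStrictFDerivAt (x := x)
  have hw := w.hasStrictFDerivAt (x := x)
  have hden := ((hu.pow 2).add (hw.pow 2)).pow 2
  have hinv := (hasStrictDerivAt_inv (pow_ne_zero 2 h)).comp_hasStrictFDerivAt x hden
  have := (hu.mul (hw.pow 4)).mul hinv
  refine this.congr_fderiv ?_
  ext v
  simp [quinticQuotientFst, quinticQuotientSnd]
  field_simp
  ring

theorem hasFDerivAt_sq_mul_sq_div {E : Type*} [NormedAddCommGroup E] [NormedSpace ℝ E]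
    (u w : E →L[ℝ] ℝ) (hu₁ : ∀ y, |u y| ≤ ‖y‖) {x : E} :
    HasFDerivAt (fun y => u y ^ 2 * w y ^ 2 / (u y ^ 2 + w y ^ 2))
      ((2 * quinticQuotient (u x) (w x)) • u + (2 * quinticQuotient (w x) (u x)) • w) x := by
  by_cases h : u x ^ 2 + w x ^ 2 = 0
  · have hux : u x = 0 := by nlinarith [sq_nonneg (u x), sq_nonneg (w x)]
    have hwx : w x = 0 := by nlinarith [sq_nonneg (u x), sq_nonneg (w x)]
    have hzero : (2 * quinticQuotient (u x) (w x)) • u + (2 * quinticQuotient (w x) (u x)) • w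
        = 0 := by
      simp [quinticQuotient, hux, hwx]
    rw [hzero]
    -- The quotient is at most `u y ^ 2`, hence quadratic in `y - x`. This also covers the points
    -- where the denominator vanishes and the quotient is 0 by convention.
    refine Asymptotics.IsBigO.hasFDerivAt (n := 2) ?_ one_lt_two
    refine Asymptotics.IsBigO.of_bound 1 (Eventually.of_forall fun y => ?_)
    have h₁ : u y ^ 2 ≤ ‖y - x‖ ^ 2 := by
      have := hu₁ (y - x)
      rw [map_sub, hux, sub_zero] at this
      exact sq_le_sq' (by linarith [neg_abs_le (u y)]) ((le_abs_self _).trans this)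
    rw [one_mul, Real.norm_eq_abs, abs_of_nonneg (by positivity), Real.norm_eq_abs,
      abs_of_nonneg (by positivity)]
    refine div_le_of_le_mul₀ (by positivity) (by positivity) ?_
    have := sq_nonneg (u y)
    gcongr
    linarith
  · have hu := u.hasFDerivAt (x := x)
    have hw := w.hasFDerivAt (x := x)
    have hden := (hu.pow 2).add (hw.pow 2)
    have hinv := (hasDerivAt_inv h).comp_hasFDerivAt x hden
    have := ((hu.pow 2).mul (hw.pow 2)).mul hinv
    refine this.congr_fderiv ?_
    have h' : w x ^ 2 + u x ^ 2 ≠ 0 := by rwa [add_comm]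
    ext v
    simp [quinticQuotient]
    field_simp
    ring

theorem hasGradientAt_saddlePotential (i j k : Fin n) (x : EuclideanSpace ℝ (Fin n)) :
    HasGradientAt (saddlePotential i j k) (saddleGradient i j k x) x := by
  rw [hasGradientAt_iff_hasFDerivAt]
  have h₁ := (hasStrictFDerivAt_norm_sq x).hasFDerivAt.mul_const (2⁻¹ : ℝ)
  have h₂ := (EuclideanSpace.proj (𝕜 := ℝ) k).hasFDerivAt (x := x).pow 2
  have h₃ := hasFDerivAt_sq_mul_sq_div (EuclideanSpace.proj (𝕜 := ℝ) i)
    (EuclideanSpace.proj (𝕜 := ℝ) j) (fun y => abs_apply_le_norm y i) (x := x)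
  refine ((h₁.sub h₂).sub (h₃.const_mul 4)).congr_fderiv ?_
  ext v
  rw [InnerProductSpace.toDual_apply_apply, saddleGradient, inner_subAxes]
  simp
  ring

/-- The differential of `saddleGradient` off `x_i = x_j = 0`. -/
noncomputable def saddleHessian (i j k : Fin n) (x : EuclideanSpace ℝ (Fin n)) :
    EuclideanSpace ℝ (Fin n) →L[ℝ] EuclideanSpace ℝ (Fin n) :=
  let e : Fin n → EuclideanSpace ℝ (Fin n) →L[ℝ] ℝ := fun l => EuclideanSpace.proj (𝕜 := ℝ) l
  ContinuousLinearMap.id ℝ _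
    - ((2 : ℝ) • e k).smulRight (EuclideanSpace.single k 1)
    - ((8 : ℝ) • (quinticQuotientFst (x i) (x j) • e i
        + quinticQuotientSnd (x i) (x j) • e j)).smulRight (EuclideanSpace.single i 1)
    - ((8 : ℝ) • (quinticQuotientFst (x j) (x i) • e j
        + quinticQuotientSnd (x j) (x i) • e i)).smulRight (EuclideanSpace.single j 1)

theorem saddleHessian_apply (i j k : Fin n) (x v : EuclideanSpace ℝ (Fin n)) :
    saddleHessian i j k x v = subAxes i j k v (2 * v k)
      (8 * (quinticQuotientFst (x i) (x j) * v i + quinticQuotientSnd (x i) (x j) * v j))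
      (8 * (quinticQuotientFst (x j) (x i) * v j + quinticQuotientSnd (x j) (x i) * v i)) := by
  simp [saddleHessian, subAxes, mul_add]

theorem hasStrictFDerivAt_saddleGradient {i j k : Fin n} {x : EuclideanSpace ℝ (Fin n)}
    (hx : x ∉ axisSubspace i j) :
    HasStrictFDerivAt (saddleGradient i j k) (saddleHessian i j k x) x := by
  have h := sq_add_sq_ne_zero_of_notMem hx
  have hi := hasStrictFDerivAt_quinticQuotient (EuclideanSpace.proj (𝕜 := ℝ) i)
    (EuclideanSpace.proj (𝕜 := ℝ) j) (x := x) h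
  have hj := hasStrictFDerivAt_quinticQuotient (EuclideanSpace.proj (𝕜 := ℝ) j)
    (EuclideanSpace.proj (𝕜 := ℝ) i) (x := x) (by rwa [add_comm] at h)
  have hk := (EuclideanSpace.proj (𝕜 := ℝ) k).hasStrictFDerivAt (x := x)
  exact (((hasStrictFDerivAt_id x).sub ((hk.const_mul 2).smul_const _)).sub
    ((hi.const_mul 8).smul_const _)).sub ((hj.const_mul 8).smul_const _)

theorem norm_saddleHessian_apply_le (i j k : Fin n) (x v : EuclideanSpace ℝ (Fin n)) :
    ‖saddleHessian i j k x v‖ ≤ 115 * ‖v‖ := by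
  rw [saddleHessian_apply]
  refine (norm_subAxes_le _ _ _ _).trans ?_
  have hi := abs_apply_le_norm v i
  have hj := abs_apply_le_norm v j
  have hk := abs_apply_le_norm v k
  have key : ∀ p q s t : ℝ, |s| ≤ ‖v‖ → |t| ≤ ‖v‖ →
      |8 * (quinticQuotientFst p q * s + quinticQuotientSnd p q * t)| ≤ 56 * ‖v‖ := by
    intro p q s t hs ht
    rw [abs_mul, abs_of_pos (by norm_num : (0 : ℝ) < 8)]
    have h₁ : |quinticQuotientFst p q * s| ≤ 3 * ‖v‖ := by
      rw [abs_mul]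
      exact mul_le_mul (abs_quinticQuotientFst_le p q) hs (abs_nonneg _) (by norm_num)
    have h₂ : |quinticQuotientSnd p q * t| ≤ 4 * ‖v‖ := by
      rw [abs_mul]
      exact mul_le_mul (abs_quinticQuotientSnd_le p q) ht (abs_nonneg _) (by norm_num)
    have := abs_add_le (quinticQuotientFst p q * s) (quinticQuotientSnd p q * t)
    linarith
  have h₁ := key (x i) (x j) _ _ hi hj
  have h₂ := key (x j) (x i) _ _ hj hi
  have h₃ : |2 * v k| ≤ 2 * ‖v‖ := by
    rw [abs_mul, abs_of_pos (by norm_num : (0 : ℝ) < 2)]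
    linarith
  linarith

/-- The differential is isometric in the remaining coordinates, and `sq_add_sq_le_of_det` handles
the planar block; `15² = 225`. -/
theorem norm_le_norm_saddleHessian_apply {i j k : Fin n} (hij : i ≠ j) (hik : i ≠ k) (hjk : j ≠ k)
    {x : EuclideanSpace ℝ (Fin n)} (hx : x ∉ axisSubspace i j) (v : EuclideanSpace ℝ (Fin n)) :
    ‖v‖ ≤ 15 * ‖saddleHessian i j k x v‖ := by
  have h := sq_add_sq_ne_zero_of_notMem hx
  set p := x i
  set q := x j
  have hFst : ∀ p q : ℝ, |1 - 8 * quinticQuotientFst p q| ≤ 25 := by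
    intro p q
    have := abs_le.1 (abs_quinticQuotientFst_le p q)
    rw [abs_le]
    constructor <;> linarith [this.1, this.2]
  have hSnd : |-(8 * quinticQuotientSnd p q)| ≤ 32 := by
    have := abs_le.1 (abs_quinticQuotientSnd_le p q)
    rw [abs_le]
    constructor <;> linarith [this.1, this.2]
  have hdet := det_quinticQuotient_le h
  have hcomm := quinticQuotientSnd_comm q p
  rw [hcomm] at hdet
  have key := sq_add_sq_le_of_det (v := v i) (w := v j) (hFst p q) hSnd (hFst q p) (by linarith)
  have hsq : v i ^ 2 + v j ^ 2 ≤ ‖v‖ ^ 2 := by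
    have h₁ := norm_subAxes_sq v 0 (v i) (v j) hij hik hjk
    have h₂ := sq_nonneg ‖subAxes i j k v 0 (v i) (v j)‖
    rw [h₁] at h₂
    linarith
  have hnorm := norm_subAxes_sq v (2 * v k)
    (8 * (quinticQuotientFst p q * v i + quinticQuotientSnd p q * v j))
    (8 * (quinticQuotientFst q p * v j + quinticQuotientSnd q p * v i)) hij hik hjk
  rw [← saddleHessian_apply, hcomm] at hnorm
  refine abs_le_of_sq_le_sq' ?_ (by positivity) |>.2
  rw [mul_pow, hnorm]
  have e₁ : v i - 8 * (quinticQuotientFst p q * v i + quinticQuotientSnd p q * v j)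
    = (1 - 8 * quinticQuotientFst p q) * v i + -(8 * quinticQuotientSnd p q) * v j := by ring
  have e₂ : v j - 8 * (quinticQuotientFst q p * v j + quinticQuotientSnd p q * v i)
    = -(8 * quinticQuotientSnd p q) * v i + (1 - 8 * quinticQuotientFst q p) * v j := by ring
  rw [e₁, e₂]
  linarith

/-- The differential is `1 - U H Uᵀ` with `Uᵀ U = 1`, so `det (1 + A B) = det (1 + B A)` reduces the
determinant to that of the 3 × 3 matrix `1 - H`. The reflection entry `1 - 2` supplies the minus
sign. -/
theorem det_saddleHessian {i j k : Fin n} (hij : i ≠ j) (hik : i ≠ k) (hjk : j ≠ k)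
    (x : EuclideanSpace ℝ (Fin n)) :
    (saddleHessian i j k x).det =
      -((1 - 8 * quinticQuotientFst (x i) (x j)) * (1 - 8 * quinticQuotientFst (x j) (x i))
        - 64 * (quinticQuotientSnd (x i) (x j) * quinticQuotientSnd (x j) (x i))) := by
  set b := (EuclideanSpace.basisFun (Fin n) ℝ).toBasis with hb
  set e : Fin 3 → Fin n := ![i, j, k] with he
  set H : Matrix (Fin 3) (Fin 3) ℝ :=
    !![8 * quinticQuotientFst (x i) (x j), 8 * quinticQuotientSnd (x i) (x j), 0;
       8 * quinticQuotientSnd (x j) (x i), 8 * quinticQuotientFst (x j) (x i), 0;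
       0, 0, 2] with hH
  set U : Matrix (Fin n) (Fin 3) ℝ := Matrix.of fun l a => if l = e a then 1 else 0 with hU
  have hUU : U.transpose * U = 1 := by
    ext a c
    have he' : Function.Injective e := by
      intro a c hac
      fin_cases a <;> fin_cases c <;> simp_all
    simp [Matrix.mul_apply, hU, Matrix.one_apply, he'.eq_iff, eq_comm]
  have hmat : LinearMap.toMatrix b b (saddleHessian i j k x).toLinearMap
      = 1 + U * (-H * U.transpose) := by
    ext l m
    rw [LinearMap.toMatrix_apply]
    simp only [Matrix.add_apply, Matrix.mul_apply, Fin.sum_univ_three]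
    clear hUU
    by_cases hm : k = m <;>
      simp [hb, saddleHessian_apply, subAxes, hU, hH, he, Matrix.one_apply, hm] <;> grind
  rw [ContinuousLinearMap.det, ← LinearMap.det_toMatrix b, hmat, Matrix.det_one_add_mul_comm,
    Matrix.mul_assoc, hUU, Matrix.mul_one, Matrix.det_fin_three]
  simp [hH]
  ring

end Saddle

/-! ### Global properties of the gradient map -/

section SaddleMap

variable {n : ℕ} {i j k : Fin n}

theorem saddleGradient_add_smul {b : EuclideanSpace ℝ (Fin n)} (hb : b ∈ axisSubspace i j)
    (s : ℝ) (z : EuclideanSpace ℝ (Fin n)) :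
    saddleGradient i j k (b + s • z) = saddleGradient i j k b + s • saddleGradient i j k z := by
  obtain ⟨hi, hj⟩ := mem_axisSubspace.1 hb
  have h0 : quinticQuotient 0 0 = 0 := by simp [quinticQuotient]
  simp only [saddleGradient, subAxes, PiLp.add_apply, PiLp.smul_apply, smul_eq_mul, hi, hj,
    zero_add, quinticQuotient_mul, h0]
  module

theorem saddleGradient_sub_of_mem {b : EuclideanSpace ℝ (Fin n)} (hb : b ∈ axisSubspace i j)
    (x : EuclideanSpace ℝ (Fin n)) :
    saddleGradient i j k x - saddleGradient i j k b = saddleGradient i j k (x - b) := by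
  have := saddleGradient_add_smul (k := k) hb 1 (x - b)
  rw [one_smul, one_smul, add_sub_cancel] at this
  rw [this, add_sub_cancel_left]

theorem norm_le_norm_saddleGradient (hij : i ≠ j) (hik : i ≠ k) (hjk : j ≠ k)
    (x : EuclideanSpace ℝ (Fin n)) : ‖x‖ ≤ ‖saddleGradient i j k x‖ := by
  refine abs_le_of_sq_le_sq' ?_ (norm_nonneg _) |>.2
  rw [saddleGradient, norm_subAxes_sq _ _ _ _ hij hik hjk]
  have := sq_add_sq_le_of_quinticQuotient (x i) (x j)
  linarith

theorem norm_saddleGradient_le (x : EuclideanSpace ℝ (Fin n)) :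
    ‖saddleGradient i j k x‖ ≤ 19 * ‖x‖ := by
  refine (norm_subAxes_le _ _ _ _).trans ?_
  have h₁ := (abs_quinticQuotient_le (x i) (x j)).trans (abs_apply_le_norm x i)
  have h₂ := (abs_quinticQuotient_le (x j) (x i)).trans (abs_apply_le_norm x j)
  have h₃ := abs_apply_le_norm x k
  rw [abs_mul, abs_mul, abs_mul, abs_of_pos (by norm_num : (0 : ℝ) < 2),
    abs_of_pos (by norm_num : (0 : ℝ) < 8)]
  linarith

theorem lipschitzWith_saddleGradient : LipschitzWith 116 (saddleGradient i j k) := by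
  refine LipschitzWith.of_eventually_edist_le fun x => ?_
  -- On the axis the bound comes from homogeneity; off it, from the bound 115 for the differential
  -- plus 1 for the remainder.
  have key : ∀ᶠ y in 𝓝 x, ‖saddleGradient i j k y - saddleGradient i j k x‖ ≤ 116 * ‖y - x‖ := by
    by_cases hx : x ∈ axisSubspace i j
    · refine Eventually.of_forall fun y => ?_
      rw [saddleGradient_sub_of_mem hx]
      linarith [norm_saddleGradient_le (i := i) (j := j) (k := k) (y - x), norm_nonneg (y - x)]
    · filter_upwards [(hasStrictFDerivAt_saddleGradient (k := k) hx).hasFDerivAt.isLittleO.def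
        one_pos] with y hy
      have h₁ := norm_saddleHessian_apply_le i j k x (y - x)
      have h₂ := norm_add_le (saddleGradient i j k y - saddleGradient i j k x
        - saddleHessian i j k x (y - x)) (saddleHessian i j k x (y - x))
      rw [sub_add_cancel] at h₂
      linarith
  filter_upwards [key] with y hy
  rw [edist_dist, edist_dist, dist_eq_norm, dist_eq_norm, ← ENNReal.ofReal_coe_nnreal,
    ← ENNReal.ofReal_mul (by positivity)]
  exact ENNReal.ofReal_le_ofReal (by exact_mod_cast hy)

theorem saddleGradient_mem_axisSubspace_iff (hij : i ≠ j) (hik : i ≠ k) (hjk : j ≠ k)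
    (x : EuclideanSpace ℝ (Fin n)) : saddleGradient i j k x ∈ axisSubspace i j ↔
      x ∈ axisSubspace i j := by
  rw [mem_axisSubspace, mem_axisSubspace, saddleGradient, subAxes_apply_fst _ _ _ _ hij hik,
    subAxes_apply_snd _ _ _ _ hij hjk]
  constructor
  · rintro ⟨h₁, h₂⟩
    have := sq_add_sq_le_of_quinticQuotient (x i) (x j)
    rw [h₁, h₂] at this
    constructor <;> nlinarith [sq_nonneg (x i), sq_nonneg (x j)]
  · rintro ⟨h₁, h₂⟩
    simp [h₁, h₂, quinticQuotient]

theorem single_notMem_axisSubspace :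
    EuclideanSpace.single i (1 : ℝ) ∉ axisSubspace (n := n) i j := by
  rw [mem_axisSubspace]
  simp

theorem isPreconnected_compl_axisSubspace (hij : i ≠ j) :
    IsPreconnected ((axisSubspace i j : Set (EuclideanSpace ℝ (Fin n)))ᶜ) := by
  refine (isConnected_compl_of_one_lt_codim ?_).isPreconnected
  have hsurj : Function.Surjective ((EuclideanSpace.proj (𝕜 := ℝ) (ι := Fin n) i).toLinearMap.prod
      (EuclideanSpace.proj (𝕜 := ℝ) j).toLinearMap) := by
    rintro ⟨s, t⟩
    refine ⟨s • EuclideanSpace.single i 1 + t • EuclideanSpace.single j 1, ?_⟩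
    simp [hij, hij.symm]
  rw [axisSubspace, (LinearMap.quotKerEquivOfSurjective _ hsurj).rank_eq, ← Module.finrank_eq_rank,
    Module.finrank_prod, Module.finrank_self]
  norm_num

theorem isDiffeoOff_saddleGradient (hij : i ≠ j) (hik : i ≠ k) (hjk : j ≠ k) :
    IsDiffeoOff (saddleGradient i j k) (axisSubspace i j : Set (EuclideanSpace ℝ (Fin n))) where
  isClosed := (axisSubspace i j).closed_of_finiteDimensional
  nonempty := ⟨0, zero_mem _⟩
  null := Measure.addHaar_submodule _ _ fun h =>
    single_notMem_axisSubspace (i := i) (j := j) (h ▸ Submodule.mem_top)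
  preconnected := isPreconnected_compl_axisSubspace hij
  mem_iff := saddleGradient_mem_axisSubspace_iff hij hik hjk
  lipschitz := ⟨116, lipschitzWith_saddleGradient⟩
  hasStrictFDerivAt x hx := by
    have h := hasStrictFDerivAt_saddleGradient (k := k) hx
    rwa [h.hasFDerivAt.fderiv]
  det_pos x hx := by
    rw [(hasStrictFDerivAt_saddleGradient (k := k) hx).hasFDerivAt.fderiv,
      det_saddleHessian hij hik hjk]
    linarith [det_quinticQuotient_le (sq_add_sq_ne_zero_of_notMem hx)]
  norm_le := ⟨15, by norm_num, fun x hx v => by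
    rw [(hasStrictFDerivAt_saddleGradient (k := k) hx).hasFDerivAt.fderiv]
    exact_mod_cast norm_le_norm_saddleHessian_apply hij hik hjk hx v⟩
  dist_le b hb x := by
    rw [dist_eq_norm, dist_eq_norm, saddleGradient_sub_of_mem hb]
    exact norm_le_norm_saddleGradient hij hik hjk _

theorem isQuasiregularMap_saddleGradient (hij : i ≠ j) (hik : i ≠ k) (hjk : j ≠ k) :
    IsQuasiregularMap (saddleGradient i j k) := by
  refine lipschitzWith_saddleGradient.isQuasiregularMap (c := 4) (by norm_num) ?_
  filter_upwards [compl_mem_ae_iff.2 (isDiffeoOff_saddleGradient hij hik hjk).null] with x hx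
  rw [(hasStrictFDerivAt_saddleGradient (k := k) hx).hasFDerivAt.fderiv,
    det_saddleHessian hij hik hjk]
  linarith [det_quinticQuotient_le (sq_add_sq_ne_zero_of_notMem hx)]

theorem saddleGradient_eq_single_iff (hij : i ≠ j) (hik : i ≠ k) (hjk : j ≠ k)
    (x : EuclideanSpace ℝ (Fin n)) : saddleGradient i j k x = EuclideanSpace.single i 1 ↔
      (x i - 8 * quinticQuotient (x i) (x j) = 1 ∧ x j - 8 * quinticQuotient (x j) (x i) = 0) ∧
        ∀ l, l ≠ i → l ≠ j → x l = 0 := by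
  constructor
  · intro h
    have hl : ∀ l, saddleGradient i j k x l = EuclideanSpace.single i (1 : ℝ) l :=
      fun l => by rw [h]
    refine ⟨⟨?_, ?_⟩, fun l hli hlj => ?_⟩
    · simpa [saddleGradient, subAxes_apply_fst _ _ _ _ hij hik] using hl i
    · simpa [saddleGradient, subAxes_apply_snd _ _ _ _ hij hjk, hij.symm] using hl j
    · rcases eq_or_ne l k with rfl | hlk
      · have := hl l
        rw [saddleGradient, subAxes_apply_third _ _ _ _ hik hjk] at this
        simp [hli] at this
        linarith
      · simpa [saddleGradient, subAxes_apply_of_ne _ _ _ _ hli hlj hlk, hli] using hl l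
  · rintro ⟨⟨h₁, h₂⟩, h⟩
    ext l
    rcases eq_or_ne l i with rfl | hli
    · rw [saddleGradient, subAxes_apply_fst _ _ _ _ hij hik, h₁]
      simp
    rcases eq_or_ne l j with rfl | hlj
    · rw [saddleGradient, subAxes_apply_snd _ _ _ _ hij hjk, h₂]
      simp [hli]
    rcases eq_or_ne l k with rfl | hlk
    · rw [saddleGradient, subAxes_apply_third _ _ _ _ hik hjk, h l hli hlj]
      simp [hli]
    · rw [saddleGradient, subAxes_apply_of_ne _ _ _ _ hli hlj hlk, h l hli hlj]
      simp [hli]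

theorem ncard_saddleGradient_fiber (hij : i ≠ j) (hik : i ≠ k) (hjk : j ≠ k) :
    (saddleGradient i j k ⁻¹' {EuclideanSpace.single i 1}).ncard = 3 := by
  obtain ⟨p, q, hq, hpq⟩ := exists_quinticQuotient_fiber
  set P : ℝ → ℝ → EuclideanSpace ℝ (Fin n) := fun s t =>
    EuclideanSpace.single i s + EuclideanSpace.single j t with hP
  have hPi : ∀ s t, P s t i = s := fun s t => by simp [hP, hij]
  have hPj : ∀ s t, P s t j = t := fun s t => by simp [hP, hij.symm]
  have hiff : ∀ (x : EuclideanSpace ℝ (Fin n)) (s t : ℝ),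
      x = P s t ↔ (x i = s ∧ x j = t) ∧ ∀ l, l ≠ i → l ≠ j → x l = 0 := by
    intro x s t
    constructor
    · rintro rfl
      exact ⟨⟨hPi s t, hPj s t⟩, fun l hi hj => by simp [hP, hi, hj]⟩
    · rintro ⟨⟨h₁, h₂⟩, h⟩
      ext l
      rcases eq_or_ne l i with rfl | hi
      · rw [h₁, hPi]
      rcases eq_or_ne l j with rfl | hj
      · rw [h₂, hPj]
      · rw [h l hi hj]
        simp [hP, hi, hj]
  have hne : ∀ {s t s' t' : ℝ}, t ≠ t' → P s t ≠ P s' t' := fun {s t s' t'} h he =>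
    h (by rw [← hPj s t, he, hPj])
  refine ncard_eq_three.2 ⟨P 1 0, P p q, P p (-q), hne hq.symm, hne (neg_ne_zero.2 hq).symm,
    hne fun h => hq (by linarith), ?_⟩
  ext x
  simp only [mem_preimage, mem_singleton_iff, mem_insert_iff, hiff]
  rw [saddleGradient_eq_single_iff hij hik hjk, hpq]
  tauto

/-- By homogeneity, two points of a common fibre can be shrunk and translated into any ball about
`b`, and their images still coincide. -/
theorem not_injOn_saddleGradient (hij : i ≠ j) (hik : i ≠ k) (hjk : j ≠ k)
    {b : EuclideanSpace ℝ (Fin n)} (hb : b ∈ axisSubspace i j) {ε : ℝ} (hε : 0 < ε) :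
    ¬ InjOn (saddleGradient i j k) (Metric.ball b ε) := by
  intro hinj
  obtain ⟨u, w, _, huw, -, -, hF⟩ := ncard_eq_three.1 (ncard_saddleGradient_fiber hij hik hjk)
  have hu : saddleGradient i j k u = EuclideanSpace.single i 1 := by
    have : u ∈ saddleGradient i j k ⁻¹' {EuclideanSpace.single i 1} := by simp [hF]
    exact this
  have hw : saddleGradient i j k w = EuclideanSpace.single i 1 := by
    have : w ∈ saddleGradient i j k ⁻¹' {EuclideanSpace.single i 1} := by simp [hF]
    exact this
  set s := ε / (‖u‖ + ‖w‖ + 1) with hs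
  have hden : 0 < ‖u‖ + ‖w‖ + 1 := by positivity
  have hs0 : 0 < s := div_pos hε hden
  have hmem : ∀ z : EuclideanSpace ℝ (Fin n), ‖z‖ < ‖u‖ + ‖w‖ + 1 →
      b + s • z ∈ Metric.ball b ε := by
    intro z hz
    rw [mem_ball_iff_norm, add_sub_cancel_left, norm_smul, Real.norm_of_nonneg hs0.le, hs,
      div_mul_eq_mul_div, div_lt_iff₀ hden]
    gcongr
  have := hinj (hmem u (by linarith [norm_nonneg w])) (hmem w (by linarith [norm_nonneg u]))
    (by rw [saddleGradient_add_smul hb, saddleGradient_add_smul hb, hu, hw])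
  exact huw (smul_right_injective _ hs0.ne' (add_left_cancel this))

theorem gradient_saddlePotential : gradient (saddlePotential i j k) = saddleGradient i j k :=
  gradient_eq fun x => hasGradientAt_saddlePotential i j k x

theorem contDiff_saddlePotential : ContDiff ℝ 1 (saddlePotential i j k) := by
  rw [contDiff_one_iff_fderiv]
  refine ⟨fun x => (hasGradientAt_saddlePotential i j k x).differentiableAt, ?_⟩
  rw [← toDual_comp_gradient, gradient_saddlePotential]
  exact (InnerProductSpace.toDual ℝ _).continuous.comp lipschitzWith_saddleGradient.continuous

end SaddleMap

theorem mainTheorem6 (n : ℕ) (hn : 3 ≤ n) :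
    ∃ ψ : EuclideanSpace ℝ (Fin n) → ℝ,
      ContDiff ℝ 1 ψ ∧
      (∀ (t : ℝ) (x : EuclideanSpace ℝ (Fin n)), ψ (t • x) = t ^ 2 * ψ x) ∧
      (¬ ∃ c : EuclideanSpace ℝ (Fin n), ∀ x, gradient ψ x = c) ∧
      IsQuasiregularMap (gradient ψ) ∧
      IsBLD (gradient ψ) ∧
      ¬ IsLocalHomeomorph (gradient ψ) ∧
      branchSet (gradient ψ) = {x | x ⟨0, by omega⟩ = 0 ∧ x ⟨1, by omega⟩ = 0} ∧
      ∀ x : EuclideanSpace ℝ (Fin n), x ⟨0, by omega⟩ = 0 → x ⟨1, by omega⟩ = 0 →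
        HasLocalIndex (gradient ψ) x 3 := by
  set i : Fin n := ⟨0, by omega⟩ with hi
  set j : Fin n := ⟨1, by omega⟩ with hj
  set k : Fin n := ⟨2, by omega⟩ with hk
  have hij : i ≠ j := by simp [hi, hj]
  have hik : i ≠ k := by simp [hi, hk]
  have hjk : j ≠ k := by simp [hj, hk]
  have h := isDiffeoOff_saddleGradient hij hik hjk
  have hbranch := h.branchSet_eq fun b hb ε hε => not_injOn_saddleGradient hij hik hjk hb hε
  refine ⟨saddlePotential i j k, contDiff_saddlePotential, saddlePotential_smul i j k, ?_⟩
  rw [gradient_saddlePotential]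
  refine ⟨?_, isQuasiregularMap_saddleGradient hij hik hjk, h.isBLD, ?_, ?_, ?_⟩
  · rintro ⟨c, hc⟩
    obtain ⟨b, hb⟩ := h.nonempty
    exact single_notMem_axisSubspace (i := i) (j := j) ((h.mem_iff _).1 (by
      rw [hc, ← hc b]
      exact (h.mem_iff b).2 hb))
  · intro hloc
    have h0 : (0 : EuclideanSpace ℝ (Fin n)) ∈ branchSet (saddleGradient i j k) := by
      rw [hbranch]
      exact zero_mem _
    exact h0 fun x _ => hloc.isLocalHomeomorphOn x (mem_univ x)
  · rw [hbranch]
    ext x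
    exact mem_axisSubspace
  · intro x hx₀ hx₁
    have := h.hasLocalIndex_ncard_fiber (mem_axisSubspace.2 ⟨hx₀, hx₁⟩)
      (single_notMem_axisSubspace (i := i) (j := j))
    rwa [ncard_saddleGradient_fiber hij hik hjk] at this
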